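/- Let $b,c,f\in C^1[0,1]$ with $b(x)\ge\beta>0$ and $c(x)\ge 0$ on $[0,1]$, and let $a>0$ and $0<q<1$. For $\varepsilon>0$ with $a\varepsilon<q$ let $u$ be the (classical) solution of $$\mathcal Lu:=-\varepsilon u''-b\,u'+c\,u=f\ \text{ in }(0,1),\qquad u(0)=u(1)=0 .$$ Let $\psi(t)=a\varepsilon\,\dfrac{t}{q-t}$ for $t<q$ and $$\alpha=\frac{q-\sqrt{a\varepsilon q(1-q+a\varepsilon)}}{1+a\varepsilon}\in(0,q),$$ which is the abscissa of the point at which the line through $(1,1)$ touches the graph of $\psi$. Let $\lambda(t)=\psi(t)$ for $t\le\alpha$ and $\lambda(t)=\psi(\alpha)+\psi'(\alpha)(t-\alpha)$ for $t\ge\alpha$. For a positive integer $N$ put $t_i=i/N$ and let the mesh points be $x_i=\lambda(t_i)$, $i=0,\dots,N$. Put $h_i=x_i-x_{i-1}$ and $\hbar_i=(h_i+h_{i+1})/2$. Let $J$ be the index with $t_{J-1}<\alpha\le t_J$, and let $H=\psi'(\alpha)/N$, which is the step size of the mesh from $x_J$ on. With $w_i=w(x_i)$, let $$\mathcal L^Nu_i=-\frac{\varepsilon}{\hbar_i}\left(\frac{u_{i+1}-u_i}{h_{i+1}}-\frac{u_i-u_{i-1}}{h_i}\right)-b_i\,\frac{u_{i+1}-u_i}{h_{i+1}}+c_iu_i,\qquad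 \tau_i[u]=\mathcal L^Nu_i-(\mathcal Lu)(x_i),$$ and let $$\tilde\tau_i[u]=\begin{cases}\dfrac{\hbar_i}{H}\,\tau_i[u], & 1\le i\le J,\\[1ex] \tau_i[u], & J+1\le i\le N-1.\end{cases}$$ Then there is a constant $C>0$, independent of $\varepsilon$, $N$ and $i$ (it may depend on $b,c,f,\beta,a,q$), such that for all $\varepsilon>0$ with $a\varepsilon<q$, all positive integers $N$ and all $i=1,2,\dots,N-1$, $$|\tilde\tau_i[u]|\le C N^{-1}.$$ -/

import Mathlib

open Set

noncomputable section

namespace VBMesh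

/-! ## The continuous problem -/

/-- The differential operator `(L u)(x) = -ε u''(x) - b(x) u'(x) + c(x) u(x)`. -/
def contOp (ε : ℝ) (b c u : ℝ → ℝ) (x : ℝ) : ℝ :=
  -ε * deriv (deriv u) x - b x * deriv u x + c x * u x

/-- `u` is a classical solution of `L u = f` in `(0, 1)`, `u(0) = u(1) = 0`. Only
`u ∈ C[0,1] ∩ C²(0,1)` is required; such a solution is automatically in `C³[0,1]` for
`C¹` data. -/
structure IsSolution (ε : ℝ) (b c f u : ℝ → ℝ) : Prop where
  continuousOn : ContinuousOn u (Icc 0 1)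
  contDiffOn : ContDiffOn ℝ 2 u (Ioo 0 1)
  eq : ∀ x ∈ Ioo (0 : ℝ) 1, contOp ε b c u x = f x
  left : u 0 = 0
  right : u 1 = 0

/-! ## The upwind scheme on a mesh `x 0 < x 1 < ... < x N` -/

/-- The step `h_i = x_i - x_{i-1}`, used for `1 ≤ i`. -/
def step (x : ℕ → ℝ) (i : ℕ) : ℝ := x i - x (i - 1)

/-- The averaged step `ℏ_i = (h_i + h_{i+1}) / 2`. -/
def avgStep (x : ℕ → ℝ) (i : ℕ) : ℝ := (step x i + step x (i + 1)) / 2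

/-- The second-order difference quotient `D'' W_i`. -/
def diff2 (x W : ℕ → ℝ) (i : ℕ) : ℝ :=
  1 / avgStep x i *
    ((W (i + 1) - W i) / step x (i + 1) - (W i - W (i - 1)) / step x i)

/-- The forward (upwind) difference quotient `D' W_i`. -/
def diff1 (x W : ℕ → ℝ) (i : ℕ) : ℝ := (W (i + 1) - W i) / step x (i + 1)

/-- The upwind difference operator `L^N W_i = -ε D'' W_i - b_i D' W_i + c_i W_i`. -/
def discOp (ε : ℝ) (b c : ℝ → ℝ) (x W : ℕ → ℝ) (i : ℕ) : ℝ :=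
  -ε * diff2 x W i - b (x i) * diff1 x W i + c (x i) * W i

/-- The consistency error `τ_i[u] = L^N u_i - (L u)(x_i)`. -/
def consistencyError (ε : ℝ) (b c : ℝ → ℝ) (x : ℕ → ℝ) (u : ℝ → ℝ) (i : ℕ) : ℝ :=
  discOp ε b c x (fun j => u (x j)) i - contOp ε b c u (x i)

/-! ## The Vulanović–Bakhvalov mesh -/

/-- The function `ψ(t) = a ε φ(t)` with `φ(t) = t / (q - t)`. -/
def psi (a q ε t : ℝ) : ℝ := a * ε * (t / (q - t))

/-- Its derivative `ψ'(t) = a ε q / (q - t)²`. -/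
def psiDeriv (a q ε t : ℝ) : ℝ := a * ε * (q / (q - t) ^ 2)

/-- The abscissa `α` at which the line through `(1, 1)` touches the graph of `ψ`. -/
def alpha (a q ε : ℝ) : ℝ :=
  (q - √(a * ε * q * (1 - q + a * ε))) / (1 + a * ε)

/-- The mesh-generating function `λ`: equal to `ψ` up to `α`, and to the tangent line of `ψ`
at `α` from there on. -/
def meshGen (a q ε t : ℝ) : ℝ :=
  if t ≤ alpha a q ε then psi a q ε t
  else psi a q ε (alpha a q ε) + psiDeriv a q ε (alpha a q ε) * (t - alpha a q ε)

/-- The mesh points `x_i = λ(i / N)`. -/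
def meshPt (a q ε : ℝ) (N i : ℕ) : ℝ := meshGen a q ε ((i : ℝ) / N)

/-- The index `J` with `(J - 1) / N < α ≤ J / N`. -/
def transIdx (a q ε : ℝ) (N : ℕ) : ℕ := ⌈alpha a q ε * N⌉₊

/-- The step size `H = x_{J+1} - x_J = ψ'(α) / N` of the uniform part of the mesh. The tangent
line defines `λ` beyond `1` too, so that `H = ψ'(α) / N` also in the case `J = N`. -/
def coarseStep (a q ε : ℝ) (N : ℕ) : ℝ :=
  meshPt a q ε N (transIdx a q ε N + 1) - meshPt a q ε N (transIdx a q ε N)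

/-- The scaled consistency error on the mesh: `(ℏ_i / H) τ_i[u]` for `i ≤ J`, and `τ_i[u]` for
`i > J`. -/
def scaledError (a q ε : ℝ) (b c : ℝ → ℝ) (N : ℕ) (u : ℝ → ℝ) (i : ℕ) : ℝ :=
  if i ≤ transIdx a q ε N then
    avgStep (meshPt a q ε N) i / coarseStep a q ε N *
      consistencyError ε b c (meshPt a q ε N) u i
  else consistencyError ε b c (meshPt a q ε N) u i

end VBMesh

end

open Set

noncomputable section

namespace VBMesh

/-! Write `L u = f` as `ε u'' + b u' = g` with `g = c u - f`, and put `γ = β / 2`. The maximum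
principle bounds `u`, and the mean value theorem gives a point `x₀ ≤ ε` with `u' = O(ε⁻¹)`. Now `u'`
solves a first-order equation `ε y' + b y = G`, and so does `u''` after differentiation. Comparison
with exponentials (`exists_bound_of_ode`) yields `u' = O(1 + ε⁻¹ E)` and `u'', ε u''' = O(1 + ε⁻²
E)`, where `E = exp (-γ x / ε)` (`exists_hasLayerBounds`).

For a stencil `s < x < t` there are two bounds on `ℏ τ`. Taylor expansion gives `O((t - s)² (1 + ε⁻²
E(s)))`. Using the differential equation instead of expanding `u''` gives `O(ε + (t - x)² + E(s))`
when `x - s ≤ t - x`.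

On the mesh, with `δ = 1 / N`, `r = q - t_{i-1}` and `t_{i-1} < α`, steps are `O(ε δ / r²)` while `3
δ ≤ r`, and `E(x_{i-1}) = O(r⁴)`. The powers of `r` cancel in the Taylor bound, so `ℏ τ = O(δ²)`. If
`r < 3 δ`, then `(q - α)² < 9 δ²`; since `ε` is comparable to `(q - α)²`, the second bound is again
`O(δ²)`. Division by `H ≥ δ / 2` gives `O(δ)`. Beyond `α`, `E = O((q - α)⁴) = O(ε²)`, and Taylor
expansion gives `τ = O(δ)` without scaling (`exists_abs_stencilError_meshGen_le`). -/

/-! ## A priori bounds for the continuous problem -/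

/-- The layer function `exp (-γ x / ε)`. -/
def layer (γ ε x : ℝ) : ℝ := Real.exp (-(γ * x / ε))

lemma layer_pos (γ ε x : ℝ) : 0 < layer γ ε x := Real.exp_pos _

lemma hasDerivAt_layer (γ ε x : ℝ) :
    HasDerivAt (layer γ ε) (-(γ / ε) * layer γ ε x) x := by
  have h : HasDerivAt (fun x : ℝ => -(γ * x / ε)) (-(γ * 1 / ε)) x :=
    (((hasDerivAt_id x).const_mul γ).div_const ε).neg
  have := h.exp
  unfold layer
  convert this using 1
  ring

lemma layer_le_layer {γ ε x y : ℝ} (hγ : 0 ≤ γ) (hε : 0 < ε) (hxy : x ≤ y) :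
    layer γ ε y ≤ layer γ ε x := by
  unfold layer
  gcongr

lemma layer_le_one {γ ε x : ℝ} (hγ : 0 ≤ γ) (hε : 0 < ε) (hx : 0 ≤ x) : layer γ ε x ≤ 1 := by
  unfold layer
  rw [Real.exp_le_one_iff]
  have : 0 ≤ γ * x / ε := by positivity
  linarith

/-- `C¹` data on `[0, 1]` are bounded together with their derivative. -/
lemma exists_bound_of_contDiffOn {g : ℝ → ℝ} (hg : ContDiffOn ℝ 1 g (Icc 0 1)) :
    ∃ M : ℝ, 0 < M ∧ (∀ x ∈ Icc (0 : ℝ) 1, |g x| ≤ M) ∧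
      ∀ x ∈ Ioo (0 : ℝ) 1, DifferentiableAt ℝ g x ∧ |deriv g x| ≤ M := by
  have hu : UniqueDiffOn ℝ (Icc (0 : ℝ) 1) := uniqueDiffOn_Icc one_pos
  obtain ⟨M₁, hM₁⟩ := isCompact_Icc.exists_bound_of_continuousOn hg.continuousOn
  obtain ⟨M₂, hM₂⟩ := isCompact_Icc.exists_bound_of_continuousOn
    (hg.continuousOn_derivWithin hu le_rfl)
  refine ⟨max 1 (max M₁ M₂), by positivity, fun x hx => ?_, fun x hx => ?_⟩
  · exact (hM₁ x hx).trans ((le_max_left _ _).trans (le_max_right _ _))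
  · have hn : Icc (0 : ℝ) 1 ∈ nhds x := Icc_mem_nhds hx.1 hx.2
    refine ⟨(hg.differentiableOn one_ne_zero).differentiableAt hn, ?_⟩
    rw [← derivWithin_of_mem_nhds hn]
    exact (hM₂ x (Ioo_subset_Icc_self hx)).trans ((le_max_right _ _).trans (le_max_right _ _))

/-! ### First-order equations `ε y' + b y = G` -/

lemma exists_antideriv {b : ℝ → ℝ} (hb : ContinuousOn b (Icc 0 1)) :
    ∃ B : ℝ → ℝ, ∀ x ∈ Ioo (0 : ℝ) 1, HasDerivAt B (b x) x := by
  refine ⟨fun x => ∫ s in (0 : ℝ)..x, b s, fun x hx => ?_⟩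
  have hn : Icc (0 : ℝ) 1 ∈ nhds x := Icc_mem_nhds hx.1 hx.2
  refine intervalIntegral.integral_hasDerivAt_right ?_ ?_ (hb.continuousAt hn)
  · apply ContinuousOn.intervalIntegrable
    rw [uIcc_of_le hx.1.le]
    exact hb.mono (Icc_subset_Icc_right hx.2.le)
  · exact hb.stronglyMeasurableAtFilter_nhdsWithin measurableSet_Icc x |>.filter_mono
      (by rw [nhdsWithin_eq_nhds.2 hn])

/-- Integrating factor: the sign of `ε d' + b d` decides the monotonicity of `d exp (B / ε)`. -/
lemma hasDerivAt_mul_exp_antideriv {ε B' d' x : ℝ} {B d : ℝ → ℝ} (hε : 0 < ε)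
    (hB : HasDerivAt B B' x) (hd : HasDerivAt d d' x) :
    HasDerivAt (fun x => d x * Real.exp (B x / ε))
      ((ε * d' + B' * d x) * (Real.exp (B x / ε) / ε)) x := by
  refine (hd.mul (hB.div_const ε).exp).congr_deriv ?_
  field_simp

/-- Comparison principle for the initial value problem of `ε d' + b d`. -/
lemma nonneg_of_ode_nonneg {ε x₀ x : ℝ} {b B d d' : ℝ → ℝ} (hε : 0 < ε)
    (hB : ∀ x ∈ Ioo (0 : ℝ) 1, HasDerivAt B (b x) x)
    (hd : ∀ x ∈ Ioo (0 : ℝ) 1, HasDerivAt d (d' x) x)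
    (hx₀ : 0 < x₀) (hx : x < 1) (hxx : x₀ ≤ x)
    (h : ∀ y ∈ Icc x₀ x, 0 ≤ ε * d' y + b y * d y) (h0 : 0 ≤ d x₀) : 0 ≤ d x := by
  have hsub : Icc x₀ x ⊆ Ioo 0 1 := fun y hy => ⟨hx₀.trans_le hy.1, hy.2.trans_lt hx⟩
  have hder := fun y (hy : y ∈ Icc x₀ x) =>
    hasDerivAt_mul_exp_antideriv hε (hB y (hsub hy)) (hd y (hsub hy))
  have hmono : MonotoneOn (fun x => d x * Real.exp (B x / ε)) (Icc x₀ x) := by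
    apply monotoneOn_of_deriv_nonneg (convex_Icc _ _)
    · exact fun y hy => (hder y hy).continuousAt.continuousWithinAt
    · exact fun y hy => (hder y (interior_subset hy)).differentiableAt.differentiableWithinAt
    · intro y hy
      rw [(hder y (interior_subset hy)).deriv]
      have := h y (interior_subset hy)
      positivity
  have := hmono (left_mem_Icc.2 hxx) (right_mem_Icc.2 hxx) hxx
  simp only at this
  have h1 : 0 ≤ d x * Real.exp (B x / ε) := le_trans (by positivity) this
  exact nonneg_of_mul_nonneg_left h1 (Real.exp_pos _)

/-- Comparison principle for the terminal value problem of `ε d' + b d`. -/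
lemma nonneg_of_ode_nonpos {ε x₀ x : ℝ} {b B d d' : ℝ → ℝ} (hε : 0 < ε)
    (hB : ∀ x ∈ Ioo (0 : ℝ) 1, HasDerivAt B (b x) x)
    (hd : ∀ x ∈ Ioo (0 : ℝ) 1, HasDerivAt d (d' x) x)
    (hx : 0 < x) (hx₀ : x₀ < 1) (hxx : x ≤ x₀)
    (h : ∀ y ∈ Icc x x₀, ε * d' y + b y * d y ≤ 0) (h0 : 0 ≤ d x₀) : 0 ≤ d x := by
  have hsub : Icc x x₀ ⊆ Ioo 0 1 := fun y hy => ⟨hx.trans_le hy.1, hy.2.trans_lt hx₀⟩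
  have hder := fun y (hy : y ∈ Icc x x₀) =>
    hasDerivAt_mul_exp_antideriv hε (hB y (hsub hy)) (hd y (hsub hy))
  have hmono : AntitoneOn (fun x => d x * Real.exp (B x / ε)) (Icc x x₀) := by
    apply antitoneOn_of_deriv_nonpos (convex_Icc _ _)
    · exact fun y hy => (hder y hy).continuousAt.continuousWithinAt
    · exact fun y hy => (hder y (interior_subset hy)).differentiableAt.differentiableWithinAt
    · intro y hy
      rw [(hder y (interior_subset hy)).deriv]
      exact mul_nonpos_of_nonpos_of_nonneg (h y (interior_subset hy)) (by positivity)
  have := hmono (left_mem_Icc.2 hxx) (right_mem_Icc.2 hxx) hxx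
  simp only at this
  have h1 : 0 ≤ d x * Real.exp (B x / ε) := le_trans (by positivity) this
  exact nonneg_of_mul_nonneg_left h1 (Real.exp_pos _)

/-- The barrier is `K / β + D E`, with `E` the layer function. The rate `γ = β / 2` leaves `b - γ ≥
γ`, which absorbs `L E`; since `x₀ ≤ ε`, `E(x₀) ≥ exp (-γ)`, so the part `Y exp γ` of `D` covers the
value at `x₀`. -/
lemma le_of_ode_forward {ε β γ M K L Y x₀ x : ℝ} {b B y y' : ℝ → ℝ} (hε : 0 < ε)
    (hγ : 0 < γ) (hβ : β = 2 * γ) (hB : ∀ x ∈ Ioo (0 : ℝ) 1, HasDerivAt B (b x) x)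
    (hb : ∀ x ∈ Ioo (0 : ℝ) 1, β ≤ b x ∧ b x ≤ M)
    (hy : ∀ x ∈ Ioo (0 : ℝ) 1, HasDerivAt y (y' x) x)
    (hK : 0 ≤ K) (hL : 0 ≤ L) (hY : 0 ≤ Y)
    (hG : ∀ x ∈ Ioo (0 : ℝ) 1, ε * y' x + b x * y x ≤ K + L * layer γ ε x)
    (hx₀ : x₀ ∈ Ioo (0 : ℝ) 1) (hx₀ε : x₀ ≤ ε) (hyx₀ : y x₀ ≤ Y) (hx : x ∈ Ioo (0 : ℝ) 1)
    (hxx : x₀ ≤ x) :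
    y x ≤ K / β + (L / γ + Y * Real.exp γ) * layer γ ε x := by
  set D := L / γ + Y * Real.exp γ with hD
  have hD0 : 0 ≤ D := by positivity
  have hβ0 : 0 < β := by linarith
  have key : 0 ≤ K / β + D * layer γ ε x - y x := by
    refine nonneg_of_ode_nonneg (x₀ := x₀) (x := x)
      (d := fun x => K / β + D * layer γ ε x - y x)
      (d' := fun x => D * (-(γ / ε) * layer γ ε x) - y' x) hε hB (fun t ht => ?_)
      hx₀.1 hx.2 hxx (fun t ht => ?_) ?_
    · exact (((hasDerivAt_layer γ ε t).const_mul D).const_add (K / β)).sub (hy t ht)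
    · have htI : t ∈ Ioo (0 : ℝ) 1 := ⟨hx₀.1.trans_le ht.1, ht.2.trans_lt hx.2⟩
      have h1 := hG t htI
      have h2 := (hb t htI).1
      have hE := layer_pos γ ε t
      have e1 : ε * (D * (-(γ / ε) * layer γ ε t) - y' t)
          + b t * (K / β + D * layer γ ε t - y t)
          = b t * (K / β) + (b t - γ) * D * layer γ ε t - (ε * y' t + b t * y t) := by
        field_simp; ring
      rw [e1]
      have h3 : K ≤ b t * (K / β) := by
        calc K = β * (K / β) := by field_simp
          _ ≤ _ := by gcongr
      have h4 : L ≤ (b t - γ) * D := by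
        calc L = γ * (L / γ) := by field_simp
          _ ≤ (b t - γ) * D := by
            apply mul_le_mul (by linarith) _ (by positivity) (by linarith)
            rw [hD]
            have : 0 ≤ Y * Real.exp γ := by positivity
            linarith
      nlinarith [mul_le_mul_of_nonneg_right h4 hE.le]
    · have h1 : Real.exp (-γ) ≤ layer γ ε x₀ := by
        unfold layer
        apply Real.exp_le_exp.2
        rw [neg_le_neg_iff, div_le_iff₀ hε]
        gcongr
      have h2 : Y ≤ D * layer γ ε x₀ := by
        calc Y = Y * Real.exp γ * Real.exp (-γ) := by
              rw [mul_assoc, ← Real.exp_add]; simp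
          _ ≤ D * layer γ ε x₀ := by
              apply mul_le_mul _ h1 (Real.exp_pos _).le hD0
              rw [hD]
              have : 0 ≤ L / γ := by positivity
              linarith
      have : 0 ≤ K / β := by positivity
      linarith
  linarith

/-- To the left of `x₀` the barrier must be a subsolution, so its decay rate `M + 1` exceeds `b`. As
`x ≤ x₀ ≤ ε`, all exponentials involved are bounded above and below, and changing the rate back to
`γ` costs only `exp γ`. -/
lemma le_of_ode_backward {ε γ M K L Y x₀ x : ℝ} {b B y y' : ℝ → ℝ} (hε : 0 < ε)
    (hγ : 0 < γ) (hB : ∀ x ∈ Ioo (0 : ℝ) 1, HasDerivAt B (b x) x)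
    (hb : ∀ x ∈ Ioo (0 : ℝ) 1, 0 ≤ b x ∧ b x ≤ M)
    (hy : ∀ x ∈ Ioo (0 : ℝ) 1, HasDerivAt y (y' x) x)
    (hK : 0 ≤ K) (hL : 0 ≤ L) (hY : 0 ≤ Y)
    (hG : ∀ x ∈ Ioo (0 : ℝ) 1, -(K + L * layer γ ε x) ≤ ε * y' x + b x * y x)
    (hx₀ : x₀ ∈ Ioo (0 : ℝ) 1) (hx₀ε : x₀ ≤ ε) (hyx₀ : y x₀ ≤ Y) (hx : x ∈ Ioo (0 : ℝ) 1)
    (hxx : x ≤ x₀) :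
    y x ≤ Real.exp (M + 1 + γ) * (K + L + Y) * layer γ ε x := by
  have hM : 0 ≤ M := (hb x hx).1.trans (hb x hx).2
  set D := Real.exp (M + 1) * (K + L + Y) with hD
  have hD0 : 0 ≤ D := by positivity
  have hlow : ∀ t ≤ x₀, K + L + Y ≤ D * layer (M + 1) ε t := fun t ht => by
    have h1 : Real.exp (-(M + 1)) ≤ layer (M + 1) ε t := by
      unfold layer
      apply Real.exp_le_exp.2
      rw [neg_le_neg_iff, div_le_iff₀ hε]
      have := ht.trans hx₀ε
      gcongr
    calc K + L + Y = Real.exp (M + 1) * Real.exp (-(M + 1)) * (K + L + Y) := by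
          rw [← Real.exp_add]; simp
      _ = D * Real.exp (-(M + 1)) := by rw [hD]; ring
      _ ≤ _ := by gcongr
  have key : 0 ≤ D * layer (M + 1) ε x - y x := by
    refine nonneg_of_ode_nonpos (x₀ := x₀) (x := x)
      (d := fun x => D * layer (M + 1) ε x - y x)
      (d' := fun x => D * (-((M + 1) / ε) * layer (M + 1) ε x) - y' x) hε hB (fun t ht => ?_)
      hx.1 hx₀.2 hxx (fun t ht => ?_) ?_
    · exact ((hasDerivAt_layer _ ε t).const_mul D).sub (hy t ht)
    · have htI : t ∈ Ioo (0 : ℝ) 1 := ⟨hx.1.trans_le ht.1, ht.2.trans_lt hx₀.2⟩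
      have h1 := hG t htI
      have h2 := (hb t htI).2
      have hE := layer_le_one (γ := γ) hγ.le hε htI.1.le
      have e1 : ε * (D * (-((M + 1) / ε) * layer (M + 1) ε t) - y' t)
          + b t * (D * layer (M + 1) ε t - y t)
          = -((M + 1 - b t) * (D * layer (M + 1) ε t)) - (ε * y' t + b t * y t) := by
        field_simp; ring
      rw [e1]
      have h3 := hlow t ht.2
      have h4 : L * layer γ ε t ≤ L := mul_le_of_le_one_right hL hE
      have h5 : 0 ≤ D * layer (M + 1) ε t := mul_nonneg hD0 (layer_pos _ _ _).le
      nlinarith [mul_nonneg (sub_nonneg.2 h2) h5]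
    · have := hlow x₀ le_rfl
      linarith
  have h1 := layer_le_one (γ := M + 1) (by linarith) hε hx.1.le
  have h2 : 1 ≤ Real.exp γ * layer γ ε x := by
    unfold layer
    rw [← Real.exp_add]
    apply Real.one_le_exp
    have : γ * x / ε ≤ γ := by
      rw [div_le_iff₀ hε]
      have := hxx.trans hx₀ε
      gcongr
    linarith
  calc y x ≤ D * layer (M + 1) ε x := by linarith
    _ ≤ D * (Real.exp γ * layer γ ε x) := by
      apply mul_le_mul_of_nonneg_left (h1.trans h2) hD0
    _ = _ := by rw [hD, Real.exp_add (M + 1) γ]; ring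

/-- Solutions of `ε y' + b y = G` are bounded up to a layer term. -/
lemma exists_bound_of_ode {γ M : ℝ} (hγ : 0 < γ) {b : ℝ → ℝ} (hbc : ContinuousOn b (Icc 0 1))
    (hb : ∀ x ∈ Ioo (0 : ℝ) 1, 2 * γ ≤ b x ∧ b x ≤ M) :
    ∃ C : ℝ, 0 < C ∧ ∀ (ε K L Y x₀ : ℝ) (y y' : ℝ → ℝ), 0 < ε → 0 ≤ K → 0 ≤ L → 0 ≤ Y →
      (∀ x ∈ Ioo (0 : ℝ) 1, HasDerivAt y (y' x) x) →
      (∀ x ∈ Ioo (0 : ℝ) 1, |ε * y' x + b x * y x| ≤ K + L * layer γ ε x) →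
      x₀ ∈ Ioo (0 : ℝ) 1 → x₀ ≤ ε → |y x₀| ≤ Y →
      ∀ x ∈ Ioo (0 : ℝ) 1, |y x| ≤ C * (K + (K + L + Y) * layer γ ε x) := by
  obtain ⟨B, hB⟩ := exists_antideriv hbc
  refine ⟨1 / γ + Real.exp γ + Real.exp (M + 1 + γ), by positivity, ?_⟩
  intro ε K L Y x₀ y y' hε hK hL hY hy hG hx₀ hx₀ε hyx₀ x hx
  have hE := layer_pos γ ε x
  have hb0 : ∀ x ∈ Ioo (0 : ℝ) 1, 0 ≤ b x ∧ b x ≤ M := fun x hx =>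
    ⟨by linarith [(hb x hx).1], (hb x hx).2⟩
  have hneg : ∀ x ∈ Ioo (0 : ℝ) 1, HasDerivAt (fun x => -y x) (-y' x) x :=
    fun x hx => (hy x hx).neg
  have e1 : ∀ x, ε * (-y' x) + b x * (-y x) = -(ε * y' x + b x * y x) := fun x => by ring
  have hg0 : (0 : ℝ) < 1 / γ := by positivity
  have hg1 := Real.exp_pos γ
  have hg2 := Real.exp_pos (M + 1 + γ)
  rcases le_total x₀ x with hxx | hxx
  · have h1 := le_of_ode_forward hε hγ rfl hB hb hy hK hL hY
      (fun x hx => (abs_le.1 (hG x hx)).2) hx₀ hx₀ε ((abs_le.1 hyx₀).2) hx hxx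
    have h2 := le_of_ode_forward hε hγ rfl hB hb hneg hK hL hY
      (fun x hx => by rw [e1]; linarith [(abs_le.1 (hG x hx)).1]) hx₀ hx₀ε
      (by linarith [(abs_le.1 hyx₀).1]) hx hxx
    have h3 : |y x| ≤ K / (2 * γ) + (L / γ + Y * Real.exp γ) * layer γ ε x :=
      abs_le.2 ⟨by linarith, h1⟩
    refine h3.trans ?_
    have e2 : K / (2 * γ) = K * (1 / γ) / 2 := by field_simp
    have e3 : L / γ = L * (1 / γ) := by field_simp
    rw [e2, e3]
    generalize 1 / γ = G at *
    generalize Real.exp γ = F at *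
    generalize Real.exp (M + 1 + γ) = F' at *
    generalize layer γ ε x = E at *
    have : 0 ≤ K * G := by positivity
    have : 0 ≤ (F + F') * (K + (K + L + Y) * E) - Y * F * E := by
      have : 0 ≤ F * K + F * (K * E) + F * (L * E) + F' * (K + (K + L + Y) * E) := by positivity
      linarith
    have : 0 ≤ G * ((K + Y) * E) := by positivity
    linarith
  · have h1 := le_of_ode_backward hε hγ hB hb0 hy hK hL hY
      (fun x hx => (abs_le.1 (hG x hx)).1) hx₀ hx₀ε ((abs_le.1 hyx₀).2) hx hxx
    have h2 := le_of_ode_backward hε hγ hB hb0 hneg hK hL hY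
      (fun x hx => by rw [e1]; linarith [(abs_le.1 (hG x hx)).2]) hx₀ hx₀ε
      (by linarith [(abs_le.1 hyx₀).1]) hx hxx
    have h3 : |y x| ≤ Real.exp (M + 1 + γ) * (K + L + Y) * layer γ ε x :=
      abs_le.2 ⟨by linarith, h1⟩
    refine h3.trans ?_
    have : 0 ≤ (1 / γ + Real.exp γ) * (K + (K + L + Y) * layer γ ε x)
        + Real.exp (M + 1 + γ) * K := by positivity
    linarith

/-! ### Maximum principle -/

lemma IsSolution.hasDerivAt {ε : ℝ} {b c f u : ℝ → ℝ} (hu : IsSolution ε b c f u) {x : ℝ}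
    (hx : x ∈ Ioo (0 : ℝ) 1) : HasDerivAt u (deriv u x) x :=
  ((hu.contDiffOn.contDiffAt (isOpen_Ioo.mem_nhds hx)).differentiableAt two_ne_zero).hasDerivAt

lemma IsSolution.hasDerivAt_deriv {ε : ℝ} {b c f u : ℝ → ℝ} (hu : IsSolution ε b c f u) {x : ℝ}
    (hx : x ∈ Ioo (0 : ℝ) 1) : HasDerivAt (deriv u) (deriv (deriv u) x) x := by
  have h := (hu.contDiffOn.deriv_of_isOpen (m := 1) isOpen_Ioo (by norm_num)).contDiffAt
    (isOpen_Ioo.mem_nhds hx)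
  exact (h.differentiableAt one_ne_zero).hasDerivAt

/-- The second derivative test: the second derivative is nonnegative at a local minimum. -/
lemma deriv_deriv_nonneg_of_isLocalMin {w : ℝ → ℝ} {x : ℝ} (h : IsLocalMin w x)
    (hc : ContinuousAt w x) : 0 ≤ deriv (deriv w) x := by
  by_contra! hneg
  -- A negative second derivative would make `x` a local maximum as well, so `w` would be locally
  -- constant.
  have hmax := isLocalMax_of_deriv_deriv_neg hneg h.deriv_eq_zero hc
  have hconst : w =ᶠ[nhds x] fun _ => w x := by
    filter_upwards [h, hmax] with y h1 h2 using le_antisymm h2 h1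
  have h1 : deriv w =ᶠ[nhds x] fun _ => 0 := by
    have := hconst.deriv
    simpa using this
  have h2 := h1.deriv_eq
  simp at h2
  linarith

/-- One-sided maximum principle bound. -/
lemma neg_le_of_contOp {ε β M : ℝ} {b c v : ℝ → ℝ} (hε : 0 < ε) (hβ : 0 < β) (hM : 0 ≤ M)
    (hbβ : ∀ x ∈ Ioo (0 : ℝ) 1, β ≤ b x) (hc0 : ∀ x ∈ Ioo (0 : ℝ) 1, 0 ≤ c x)
    (hv : ContinuousOn v (Icc 0 1)) (hv1 : ∀ x ∈ Ioo (0 : ℝ) 1, HasDerivAt v (deriv v x) x)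
    (hv2 : ∀ x ∈ Ioo (0 : ℝ) 1, HasDerivAt (deriv v) (deriv (deriv v) x) x)
    (hL : ∀ x ∈ Ioo (0 : ℝ) 1, -M ≤ contOp ε b c v x) (h0 : v 0 = 0) (h1 : v 1 = 0)
    {x : ℝ} (hx : x ∈ Icc (0 : ℝ) 1) : -((M + 1) / β) ≤ v x := by
  -- The barrier `A (1 - x)` satisfies `L (A (1 - x)) ≥ b A ≥ M + 1`; the extra `1` makes the
  -- contradiction at a negative interior minimum strict.
  set A := (M + 1) / β with hA
  have hA0 : 0 < A := by positivity
  set w : ℝ → ℝ := fun x => v x + A * (1 - x) with hw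
  have hwc : ContinuousOn w (Icc 0 1) := hv.add (by fun_prop)
  obtain ⟨z, hz, hmin⟩ := isCompact_Icc.exists_isMinOn (nonempty_Icc.2 zero_le_one) hwc
  have hwz : 0 ≤ w z := by
    by_contra! hneg
    have hz0 : z ≠ 0 := by
      rintro rfl
      simp only [hw, h0] at hneg
      linarith
    have hz1 : z ≠ 1 := by
      rintro rfl
      simp [hw, h1] at hneg
    have hzI : z ∈ Ioo (0 : ℝ) 1 := ⟨lt_of_le_of_ne hz.1 hz0.symm, lt_of_le_of_ne hz.2 hz1⟩
    have hlm : IsLocalMin w z := hmin.isLocalMin (Icc_mem_nhds hzI.1 hzI.2)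
    have hdw : ∀ y ∈ Ioo (0 : ℝ) 1, HasDerivAt w (deriv v y - A) y := fun y hy => by
      have := (hv1 y hy).add (((hasDerivAt_id y).const_sub 1).const_mul A)
      exact this.congr_deriv (by ring)
    have hdd : deriv (deriv w) z = deriv (deriv v) z := by
      have h2 : deriv w =ᶠ[nhds z] fun y => deriv v y - A := by
        filter_upwards [isOpen_Ioo.mem_nhds hzI] with y hy using (hdw y hy).deriv
      rw [h2.deriv_eq, ((hv2 z hzI).sub_const A).deriv]
    have h2 := deriv_deriv_nonneg_of_isLocalMin hlm (hdw z hzI).continuousAt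
    rw [hdd] at h2
    have h3 : deriv v z = A := by
      have := hlm.deriv_eq_zero
      rw [(hdw z hzI).deriv] at this
      linarith
    have h4 := hL z hzI
    unfold contOp at h4
    rw [h3] at h4
    have h5 : M + 1 ≤ b z * A := by
      calc M + 1 = β * A := by rw [hA]; field_simp
        _ ≤ _ := by gcongr; exact hbβ z hzI
    have h6 : c z * v z ≤ 0 := by
      apply mul_nonpos_of_nonneg_of_nonpos (hc0 z hzI)
      simp only [hw] at hneg
      nlinarith [hzI.2]
    nlinarith [mul_nonneg hε.le h2]
  have h2 : w z ≤ w x := hmin hx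
  simp only [hw] at h2 hwz
  nlinarith [hx.1]

lemma IsSolution.abs_le_of_abs_rhs_le {ε β M : ℝ} {b c f u : ℝ → ℝ} (hu : IsSolution ε b c f u) (hε : 0 < ε)
    (hβ : 0 < β) (hbβ : ∀ x ∈ Ioo (0 : ℝ) 1, β ≤ b x) (hc0 : ∀ x ∈ Ioo (0 : ℝ) 1, 0 ≤ c x)
    (hM : 0 ≤ M) (hf : ∀ x ∈ Ioo (0 : ℝ) 1, |f x| ≤ M) {x : ℝ} (hx : x ∈ Icc (0 : ℝ) 1) :
    |u x| ≤ (M + 1) / β := by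
  have h1 := neg_le_of_contOp hε hβ hM hbβ hc0 hu.continuousOn (fun x hx => hu.hasDerivAt hx)
    (fun x hx => hu.hasDerivAt_deriv hx)
    (fun x hx => by rw [hu.eq x hx]; exact (abs_le.1 (hf x hx)).1) hu.left hu.right hx
  have e1 : deriv (fun x => -u x) = fun x => -deriv u x := by
    funext x; exact deriv.fun_neg
  have e2 : deriv (deriv (fun x => -u x)) = fun x => -deriv (deriv u) x := by
    rw [e1]; funext x; exact deriv.fun_neg
  have h2 := neg_le_of_contOp (v := fun x => -u x) hε hβ hM hbβ hc0 hu.continuousOn.neg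
    (fun x hx => by rw [e1]; exact (hu.hasDerivAt hx).neg)
    (fun x hx => by rw [e2, e1]; exact (hu.hasDerivAt_deriv hx).neg)
    (fun x hx => by
      have h := hu.eq x hx
      have h' := (abs_le.1 (hf x hx)).2
      unfold contOp at h ⊢
      rw [e2, e1]
      linarith) (by simp [hu.left]) (by simp [hu.right]) hx
  exact abs_le.2 ⟨h1, by linarith⟩

/-! ### Layer bounds for the derivatives -/

/-- Derivative bounds of a solution of `ε u'' + b u' = g` with an exponential layer at `0`. -/
structure HasLayerBounds (C γ ε : ℝ) (b g u : ℝ → ℝ) : Prop where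
  continuousOn : ContinuousOn u (Icc 0 1)
  hasDerivAt : ∀ x ∈ Ioo (0 : ℝ) 1, HasDerivAt u (deriv u x) x
  hasDerivAt_deriv : ∀ x ∈ Ioo (0 : ℝ) 1, HasDerivAt (deriv u) (deriv (deriv u) x) x
  eq : ∀ x ∈ Ioo (0 : ℝ) 1, ε * deriv (deriv u) x + b x * deriv u x = g x
  abs_deriv_le : ∀ x ∈ Ioo (0 : ℝ) 1, |deriv u x| ≤ C * (1 + ε⁻¹ * layer γ ε x)
  abs_deriv2_le : ∀ x ∈ Ioo (0 : ℝ) 1, |deriv (deriv u) x| ≤ C * (1 + ε⁻¹ ^ 2 * layer γ ε x)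
  differentiableAt_deriv2 : ∀ x ∈ Ioo (0 : ℝ) 1, DifferentiableAt ℝ (deriv (deriv u)) x
  abs_deriv3_le : ∀ x ∈ Ioo (0 : ℝ) 1,
    |ε * deriv (deriv (deriv u)) x| ≤ C * (1 + ε⁻¹ ^ 2 * layer γ ε x)
  differentiableAt_rhs : ∀ x ∈ Ioo (0 : ℝ) 1, DifferentiableAt ℝ g x
  abs_deriv_rhs_le : ∀ x ∈ Ioo (0 : ℝ) 1, |deriv g x| ≤ C * (1 + ε⁻¹ * layer γ ε x)

/-- Near the left boundary there is a point where the derivative is of order `ε⁻¹`. -/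
lemma IsSolution.exists_abs_deriv_le {ε ε₁ U : ℝ} {b c f u : ℝ → ℝ}
    (hu : IsSolution ε b c f u) (hε : 0 < ε) (hε₁ : ε ≤ ε₁)
    (hU : ∀ x ∈ Icc (0 : ℝ) 1, |u x| ≤ U) :
    ∃ x₀ ∈ Ioo (0 : ℝ) 1, x₀ ≤ ε ∧ |deriv u x₀| ≤ U * (2 * ε₁ + 1) * ε⁻¹ := by
  -- `ε` may exceed `1`; this choice keeps `δ` below both `ε` and `1` while staying comparable to
  -- `ε`.
  set δ := ε / (2 * ε₁ + 1) with hδ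
  have h1 : 0 < 2 * ε₁ + 1 := by linarith
  have hδ0 : 0 < δ := by positivity
  have hδ1 : δ < 1 := by rw [hδ, div_lt_one h1]; linarith
  have hδε : δ ≤ ε := div_le_self hε.le (by linarith)
  obtain ⟨z, hz, hz'⟩ := exists_hasDerivAt_eq_slope u (deriv u) hδ0
    (hu.continuousOn.mono (Icc_subset_Icc_right hδ1.le))
    (fun x hx => hu.hasDerivAt ⟨hx.1, hx.2.trans hδ1⟩)
  refine ⟨z, ⟨hz.1, hz.2.trans hδ1⟩, hz.2.le.trans hδε, ?_⟩
  rw [hz', hu.left, sub_zero, sub_zero, abs_div, abs_of_pos hδ0, div_le_iff₀ hδ0]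
  calc |u δ| ≤ U := hU δ ⟨hδ0.le, hδ1.le⟩
    _ = _ := by rw [hδ]; field_simp

/-- The solution satisfies the layer bounds with constants independent of `ε`. -/
lemma exists_hasLayerBounds {b c f : ℝ → ℝ} {γ ε₁ : ℝ}
    (hb : ContDiffOn ℝ 1 b (Icc 0 1)) (hc : ContDiffOn ℝ 1 c (Icc 0 1))
    (hf : ContDiffOn ℝ 1 f (Icc 0 1)) (hγ : 0 < γ)
    (hbγ : ∀ x ∈ Icc (0 : ℝ) 1, 2 * γ ≤ b x) (hc0 : ∀ x ∈ Icc (0 : ℝ) 1, 0 ≤ c x)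
    (hε₁ : 1 ≤ ε₁) :
    ∃ C : ℝ, 0 < C ∧ ∀ ε : ℝ, 0 < ε → ε ≤ ε₁ → ∀ u : ℝ → ℝ, IsSolution ε b c f u →
      HasLayerBounds C γ ε b (fun x => c x * u x - f x) u := by
  obtain ⟨Mb, hMb, hb0, hb1⟩ := exists_bound_of_contDiffOn hb
  obtain ⟨Mc, hMc, hcb, hc1⟩ := exists_bound_of_contDiffOn hc
  obtain ⟨Mf, hMf, hf0, hf1⟩ := exists_bound_of_contDiffOn hf
  obtain ⟨C₀, hC₀, hode⟩ := exists_bound_of_ode (M := Mb) hγ hb.continuousOn (fun x hx =>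
    ⟨hbγ x (Ioo_subset_Icc_self hx), (abs_le.1 (hb0 x (Ioo_subset_Icc_self hx))).2⟩)
  set U := (Mf + 1) / (2 * γ) with hU
  have hU0 : 0 < U := by positivity
  -- The constants bound, in order, `g`, `u'`, `g'`, `g' - b' u'`, `u''` and `ε u'''`.
  set G₀ := Mc * U + Mf with hG₀
  set C₁ := C₀ * (G₀ + G₀ * ε₁ + U * (2 * ε₁ + 1)) with hC₁
  set C₂ := Mc * U + Mc * C₁ + Mf with hC₂
  set C₃ := C₂ + Mb * C₁ with hC₃
  set C₄ := C₀ * (C₃ + C₃ * ε₁ ^ 2 + C₃ * ε₁ + (G₀ + Mb * C₁) * ε₁ + Mb * C₁) with hC₄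
  set C₅ := C₃ * (1 + ε₁) + Mb * C₄ with hC₅
  have hG₀0 : 0 < G₀ := by positivity
  have hC₁0 : 0 < C₁ := by positivity
  have hC₂0 : 0 < C₂ := by positivity
  have hC₃0 : 0 < C₃ := by positivity
  have hC₄0 : 0 < C₄ := by positivity
  have hC₅0 : 0 < C₅ := by positivity
  clear_value C₅ C₄ C₃ C₂ C₁ G₀ U
  refine ⟨C₁ + C₂ + C₄ + C₅, by positivity, fun ε hε hεε₁ u hu => ?_⟩
  set g : ℝ → ℝ := fun x => c x * u x - f x with hg
  set η := ε⁻¹ with hη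
  have hη0 : 0 < η := by positivity
  have hεη : ε * η = 1 := mul_inv_cancel₀ hε.ne'
  -- Lower powers of `ε⁻¹` are absorbed into higher ones through this inequality.
  have h1η : 1 ≤ ε₁ * η := by
    rw [← hεη]; gcongr
  have hsub : ∀ x ∈ Ioo (0 : ℝ) 1, x ∈ Icc (0 : ℝ) 1 := fun x hx => Ioo_subset_Icc_self hx
  have hubd : ∀ x ∈ Icc (0 : ℝ) 1, |u x| ≤ U := fun x hx => hU ▸
    hu.abs_le_of_abs_rhs_le hε (by positivity) (fun x hx => hbγ x (hsub x hx))
      (fun x hx => hc0 x (hsub x hx)) hMf.le (fun x hx => hf0 x (hsub x hx)) hx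
  have hgbd : ∀ x ∈ Ioo (0 : ℝ) 1, |g x| ≤ G₀ := fun x hx => by
    calc |g x| ≤ |c x * u x| + |f x| := abs_sub _ _
      _ ≤ Mc * U + Mf := by
        rw [abs_mul]
        have h1 := hcb x (hsub x hx)
        have h2 := hubd x (hsub x hx)
        have h3 := hf0 x (hsub x hx)
        gcongr
      _ = G₀ := hG₀.symm
  have heq : ∀ x ∈ Ioo (0 : ℝ) 1, ε * deriv (deriv u) x + b x * deriv u x = g x :=
    fun x hx => by
      have := hu.eq x hx
      unfold contOp at this
      simp only [hg]
      linarith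
  obtain ⟨x₀, hx₀, hx₀ε, hdx₀⟩ := hu.exists_abs_deriv_le hε hεε₁ hubd
  have hE : ∀ x, 0 < layer γ ε x := layer_pos γ ε
  have hd1 : ∀ x ∈ Ioo (0 : ℝ) 1, |deriv u x| ≤ C₁ * (1 + η * layer γ ε x) := fun x hx => by
    have h := hode ε G₀ 0 (U * (2 * ε₁ + 1) * η) x₀ (deriv u) (deriv (deriv u)) hε hG₀0.le le_rfl
      (by positivity) (fun x hx => hu.hasDerivAt_deriv hx)
      (fun x hx => by rw [heq x hx]; simpa using hgbd x hx) hx₀ hx₀ε hdx₀ x hx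
    refine h.trans ?_
    rw [hC₁, mul_assoc C₀]
    apply mul_le_mul_of_nonneg_left _ hC₀.le
    have h1 : 0 ≤ G₀ * layer γ ε x * (ε₁ * η - 1) :=
      mul_nonneg (mul_pos hG₀0 (hE x)).le (by linarith)
    have h2 : 0 ≤ G₀ * (η * layer γ ε x) + G₀ * ε₁ + U * (2 * ε₁ + 1) := by
      have := hE x; positivity
    linarith
  have hgd : ∀ x ∈ Ioo (0 : ℝ) 1,
      HasDerivAt g (deriv c x * u x + c x * deriv u x - deriv f x) x := fun x hx =>
    ((hc1 x hx).1.hasDerivAt.mul (hu.hasDerivAt hx)).sub (hf1 x hx).1.hasDerivAt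
  have hg1 : ∀ x ∈ Ioo (0 : ℝ) 1, |deriv g x| ≤ C₂ * (1 + η * layer γ ε x) := fun x hx => by
    rw [(hgd x hx).deriv]
    have h1 := (hc1 x hx).2
    have h2 := hubd x (hsub x hx)
    have h3 := (hf1 x hx).2
    have h4 := hd1 x hx
    have h5 := hcb x (hsub x hx)
    have hηE : 0 < η * layer γ ε x := mul_pos hη0 (hE x)
    calc _ ≤ |deriv c x * u x| + |c x * deriv u x| + |deriv f x| :=
          (abs_sub _ _).trans (by gcongr; exact abs_add_le _ _)
      _ ≤ Mc * U + Mc * (C₁ * (1 + η * layer γ ε x)) + Mf := by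
        rw [abs_mul, abs_mul]; gcongr
      _ ≤ _ := by
        rw [hC₂]
        have : 0 ≤ (Mc * U + Mf) * (η * layer γ ε x) := by positivity
        linarith
  -- Near `x`, `u'' = (g - b u') / ε`, whose right side is differentiable; this supplies the third
  -- derivative.
  have hzeq : ∀ x ∈ Ioo (0 : ℝ) 1,
      HasDerivAt (deriv (deriv u)) ((deriv g x - (deriv b x * deriv u x +
        b x * deriv (deriv u) x)) / ε) x := fun x hx => by
    have h1 := ((hgd x hx).differentiableAt.hasDerivAt.sub
      ((hb1 x hx).1.hasDerivAt.mul (hu.hasDerivAt_deriv hx))).div_const ε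
    refine h1.congr_of_eventuallyEq ?_
    filter_upwards [isOpen_Ioo.mem_nhds hx] with y hy
    have := heq y hy
    simp only [Pi.sub_apply, Pi.mul_apply]
    field_simp
    linarith
  have hrhs : ∀ x ∈ Ioo (0 : ℝ) 1, |deriv g x - deriv b x * deriv u x|
      ≤ C₃ * (1 + η * layer γ ε x) := fun x hx => by
    have h1 := hg1 x hx
    have h2 := (hb1 x hx).2
    have h3 := hd1 x hx
    calc _ ≤ |deriv g x| + |deriv b x| * |deriv u x| := by
          rw [← abs_mul]; exact abs_sub _ _
      _ ≤ C₂ * (1 + η * layer γ ε x) + Mb * (C₁ * (1 + η * layer γ ε x)) := by gcongr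
      _ = _ := by rw [hC₃]; ring
  have hd2 : ∀ x ∈ Ioo (0 : ℝ) 1,
      |deriv (deriv u) x| ≤ C₄ * (1 + η ^ 2 * layer γ ε x) := fun x hx => by
    -- The starting value for `u''` is read off the differential equation at `x₀`.
    have hz₀ : |deriv (deriv u) x₀| ≤ η * (G₀ + Mb * (C₁ * (1 + η))) := by
      have e1 : deriv (deriv u) x₀ = η * (g x₀ - b x₀ * deriv u x₀) := by
        rw [← heq x₀ hx₀]
        linear_combination (-(deriv (deriv u) x₀)) * hεη
      rw [e1, abs_mul, abs_of_pos hη0]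
      gcongr
      refine (abs_sub _ _).trans ?_
      rw [abs_mul]
      have h1 := hgbd x₀ hx₀
      have h2 := hb0 x₀ (hsub x₀ hx₀)
      have h3 := hd1 x₀ hx₀
      have h4 := layer_le_one hγ.le hε hx₀.1.le
      have h5 : |deriv u x₀| ≤ C₁ * (1 + η) := by
        refine h3.trans ?_
        gcongr
        exact mul_le_of_le_one_right hη0.le h4
      gcongr
    have h := hode ε C₃ (C₃ * η) (η * (G₀ + Mb * (C₁ * (1 + η)))) x₀ (deriv (deriv u)) _ hε
      hC₃0.le (by positivity) (by positivity) hzeq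
      (fun x hx => by
        refine le_trans (le_of_eq ?_) ((hrhs x hx).trans (le_of_eq (by ring)))
        congr 1
        field_simp
        ring) hx₀ hx₀ε hz₀ x hx
    refine h.trans ?_
    rw [hC₄, mul_assoc C₀]
    apply mul_le_mul_of_nonneg_left _ hC₀.le
    have hEx := hE x
    generalize layer γ ε x = E at hEx ⊢
    have hη1 : η ≤ ε₁ * η ^ 2 := by nlinarith
    have hη2 : 1 ≤ ε₁ ^ 2 * η ^ 2 := by nlinarith
    have h1 : 0 ≤ C₃ * E * (ε₁ ^ 2 * η ^ 2 - 1) :=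
      mul_nonneg (by positivity) (by linarith)
    have h2 : 0 ≤ (C₃ + (G₀ + Mb * C₁)) * E * (ε₁ * η ^ 2 - η) :=
      mul_nonneg (by positivity) (by linarith)
    have h3 : 0 ≤ C₃ * (η ^ 2 * E) + C₃ * ε₁ ^ 2 + C₃ * ε₁ + (G₀ + Mb * C₁) * ε₁ + Mb * C₁ := by
      positivity
    linarith
  have hle : ∀ {A : ℝ} (X : ℝ), 0 ≤ X → A ≤ C₁ + C₂ + C₄ + C₅ → A * X ≤ (C₁ + C₂ + C₄ + C₅) * X :=
    fun X hX h => mul_le_mul_of_nonneg_right h hX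
  have hX1 : ∀ x, 0 ≤ 1 + η * layer γ ε x := fun x => by have := hE x; positivity
  have hX2 : ∀ x, 0 ≤ 1 + η ^ 2 * layer γ ε x := fun x => by have := hE x; positivity
  refine ⟨hu.continuousOn, fun x hx => hu.hasDerivAt hx, fun x hx => hu.hasDerivAt_deriv hx, heq,
    fun x hx => (hd1 x hx).trans (hle _ (hX1 x) (by linarith)),
    fun x hx => (hd2 x hx).trans (hle _ (hX2 x) (by linarith)),
    fun x hx => (hzeq x hx).differentiableAt, fun x hx => ?_,
    fun x hx => (hgd x hx).differentiableAt,
    fun x hx => (hg1 x hx).trans (hle _ (hX1 x) (by linarith))⟩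
  refine le_trans ?_ (hle (A := C₅) _ (hX2 x) (by linarith))
  rw [(hzeq x hx).deriv]
  have e1 : ε * ((deriv g x - (deriv b x * deriv u x + b x * deriv (deriv u) x)) / ε)
      = (deriv g x - deriv b x * deriv u x) - b x * deriv (deriv u) x := by
    field_simp; ring
  rw [e1]
  have h1 := hrhs x hx
  have h2 := hb0 x (hsub x hx)
  have h3 := hd2 x hx
  have hηE : η * layer γ ε x ≤ ε₁ * (η ^ 2 * layer γ ε x) := by
    have : 0 ≤ η * layer γ ε x * (ε₁ * η - 1) :=
      mul_nonneg (mul_pos hη0 (hE x)).le (by linarith)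
    linarith
  have hpos := mul_pos (pow_pos hη0 2) (hE x)
  calc _ ≤ |deriv g x - deriv b x * deriv u x| + |b x| * |deriv (deriv u) x| := by
        rw [← abs_mul]; exact abs_sub _ _
    _ ≤ C₃ * (1 + η * layer γ ε x) + Mb * (C₄ * (1 + η ^ 2 * layer γ ε x)) := by gcongr
    _ ≤ C₃ * (1 + ε₁ * (η ^ 2 * layer γ ε x)) + Mb * (C₄ * (1 + η ^ 2 * layer γ ε x)) := by gcongr
    _ ≤ _ := by
      rw [hC₅]
      have : 0 ≤ C₃ * (ε₁ + η ^ 2 * layer γ ε x) := by positivity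
      linarith

/-! ## Truncation errors -/

/-- `ℏ τ` for the three-point stencil `s < x < t`. -/
def stencilError (ε : ℝ) (b u : ℝ → ℝ) (s x t : ℝ) : ℝ :=
  -ε * ((u t - u x) / (t - x) - (u x - u s) / (x - s)) + (t - s) / 2 * (ε * deriv (deriv u) x) -
    b x * ((t - s) / 2) * ((u t - u x) / (t - x) - deriv u x)

/-- Cauchy's mean value theorem against `(y - x)²`, then the mean value theorem for `u'`. Only
continuity of `u` is needed at `t`, which may be the boundary point `1`. -/
lemma exists_taylor_right {u : ℝ → ℝ} {x t : ℝ} (hu : ContinuousOn u (Icc 0 1))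
    (h1 : ∀ x ∈ Ioo (0 : ℝ) 1, HasDerivAt u (deriv u x) x)
    (h2 : ∀ x ∈ Ioo (0 : ℝ) 1, HasDerivAt (deriv u) (deriv (deriv u) x) x)
    (hx : 0 < x) (hxt : x < t) (ht : t ≤ 1) :
    ∃ ξ ∈ Ioo x t, (u t - u x) / (t - x) = deriv u x + deriv (deriv u) ξ * ((t - x) / 2) := by
  obtain ⟨z, hz, hz'⟩ := exists_ratio_hasDerivAt_eq_ratio_slope
    (fun y => u y - deriv u x * y) (fun y => deriv u y - deriv u x * 1) hxt
    ((hu.mono (Icc_subset_Icc hx.le ht)).sub (by fun_prop))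
    (fun y hy => (h1 y ⟨hx.trans hy.1, hy.2.trans_le ht⟩).sub
      ((hasDerivAt_id y).const_mul (deriv u x)))
    (fun y => (y - x) ^ 2) (fun y => 2 * (y - x)) (by fun_prop)
    (fun y _ => by simpa [Pi.pow_def] using ((hasDerivAt_id y).sub_const x).pow 2)
  obtain ⟨ξ, hξ, hξ'⟩ := exists_hasDerivAt_eq_slope (deriv u) (deriv (deriv u)) hz.1
    (fun y hy => (h2 y ⟨hx.trans_le hy.1,
      (hy.2.trans_lt hz.2).trans_le ht⟩).continuousAt.continuousWithinAt)
    (fun y hy => h2 y ⟨hx.trans hy.1, (hy.2.trans hz.2).trans_le ht⟩)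
  refine ⟨ξ, ⟨hξ.1, hξ.2.trans hz.2⟩, ?_⟩
  have hzx : z - x ≠ 0 := (sub_pos.2 hz.1).ne'
  have htx : t - x ≠ 0 := (sub_pos.2 hxt).ne'
  rw [eq_div_iff hzx] at hξ'
  rw [div_eq_iff htx]
  rw [show deriv u z = deriv u x + deriv (deriv u) ξ * (z - x) by linarith] at hz'
  have := mul_right_cancel₀ hzx (show ((t - x) ^ 2 * deriv (deriv u) ξ) * (z - x)
    = (2 * (u t - u x - deriv u x * (t - x))) * (z - x) by linarith)
  linarith

lemma exists_taylor_left {u : ℝ → ℝ} {s x : ℝ} (hu : ContinuousOn u (Icc 0 1))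
    (h1 : ∀ x ∈ Ioo (0 : ℝ) 1, HasDerivAt u (deriv u x) x)
    (h2 : ∀ x ∈ Ioo (0 : ℝ) 1, HasDerivAt (deriv u) (deriv (deriv u) x) x)
    (hs : 0 ≤ s) (hsx : s < x) (hx : x < 1) :
    ∃ ξ ∈ Ioo s x, (u x - u s) / (x - s) = deriv u x - deriv (deriv u) ξ * ((x - s) / 2) := by
  obtain ⟨z, hz, hz'⟩ := exists_ratio_hasDerivAt_eq_ratio_slope
    (fun y => u y - deriv u x * y) (fun y => deriv u y - deriv u x * 1) hsx
    ((hu.mono (Icc_subset_Icc hs hx.le)).sub (by fun_prop))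
    (fun y hy => (h1 y ⟨hs.trans_lt hy.1, hy.2.trans hx⟩).sub
      ((hasDerivAt_id y).const_mul (deriv u x)))
    (fun y => (y - x) ^ 2) (fun y => 2 * (y - x)) (by fun_prop)
    (fun y _ => by simpa [Pi.pow_def] using ((hasDerivAt_id y).sub_const x).pow 2)
  obtain ⟨ξ, hξ, hξ'⟩ := exists_hasDerivAt_eq_slope (deriv u) (deriv (deriv u)) hz.2
    (fun y hy => (h2 y ⟨hs.trans_lt (hz.1.trans_le hy.1),
      hy.2.trans_lt hx⟩).continuousAt.continuousWithinAt)
    (fun y hy => h2 y ⟨hs.trans_lt (hz.1.trans hy.1), hy.2.trans hx⟩)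
  refine ⟨ξ, ⟨hz.1.trans hξ.1, hξ.2⟩, ?_⟩
  have hzx : x - z ≠ 0 := (sub_pos.2 hz.2).ne'
  have htx : x - s ≠ 0 := (sub_pos.2 hsx).ne'
  rw [eq_div_iff hzx] at hξ'
  rw [div_eq_iff htx]
  rw [show deriv u z = deriv u x - deriv (deriv u) ξ * (x - z) by linarith] at hz'
  have := mul_right_cancel₀ hzx (show ((x - s) ^ 2 * deriv (deriv u) ξ) * (x - z)
    = (-2 * (u x - u s - deriv u x * (x - s))) * (x - z) by linarith)
  linarith

/-- Truncation error bound by Taylor expansion. -/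
lemma HasLayerBounds.abs_stencilError_le {C γ ε M s x t : ℝ} {b g u : ℝ → ℝ}
    (hu : HasLayerBounds C γ ε b g u) (hC : 0 < C) (hγ : 0 < γ) (hε : 0 < ε) (hM : 0 ≤ M)
    (hs : 0 ≤ s) (hsx : s < x) (hxt : x < t) (ht : t ≤ 1) (hb : |b x| ≤ M) :
    |stencilError ε b u s x t| ≤
      C * (1 + M) * ((t - s) / 2) * ((t - s) * (1 + ε⁻¹ ^ 2 * layer γ ε s)) := by
  set W := 1 + ε⁻¹ ^ 2 * layer γ ε s with hW
  have hE := layer_pos γ ε s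
  have hW0 : 0 < W := by positivity
  have hI : ∀ y ∈ Ioo s t, y ∈ Ioo (0 : ℝ) 1 := fun y hy => ⟨hs.trans_lt hy.1, hy.2.trans_le ht⟩
  have hWle : ∀ y ∈ Ioo s t, 1 + ε⁻¹ ^ 2 * layer γ ε y ≤ W := fun y hy => by
    have := layer_le_layer hγ.le hε hy.1.le
    rw [hW]; gcongr
  obtain ⟨ξ, hξ, e1⟩ := exists_taylor_right hu.continuousOn hu.hasDerivAt hu.hasDerivAt_deriv
    (hs.trans_lt hsx) hxt ht
  obtain ⟨ζ, hζ, e2⟩ := exists_taylor_left hu.continuousOn hu.hasDerivAt hu.hasDerivAt_deriv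
    hs hsx (hxt.trans_le ht)
  have hξI : ξ ∈ Ioo s t := ⟨hsx.trans hξ.1, hξ.2⟩
  have hζI : ζ ∈ Ioo s t := ⟨hζ.1, hζ.2.trans hxt⟩
  have hxI : x ∈ Ioo s t := ⟨hsx, hxt⟩
  -- After the expansion, `u''` enters with `ε` only through differences, which the bound on `ε
  -- u'''` controls.
  have hdiff : ∀ y ∈ Ioo s t,
      |ε * (deriv (deriv u) y - deriv (deriv u) x)| ≤ C * W * (t - s) := fun y hy => by
    have h := (convex_Ioo s t).norm_image_sub_le_of_norm_hasDerivWithin_le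
      (f := fun y => ε * deriv (deriv u) y) (C := C * W)
      (fun z hz => ((hu.differentiableAt_deriv2 z (hI z hz)).hasDerivAt.const_mul
        ε).hasDerivWithinAt)
      (fun z hz => (hu.abs_deriv3_le z (hI z hz)).trans (by gcongr; exact hWle z hz)) hxI hy
    rw [mul_sub]
    refine h.trans ?_
    gcongr
    rw [Real.norm_eq_abs, abs_le]
    constructor <;> linarith [hy.1, hy.2]
  have h1 := hdiff ξ hξI
  have h2 := hdiff ζ hζI
  have h3 : |deriv (deriv u) ξ| ≤ C * W :=
    (hu.abs_deriv2_le ξ (hI ξ hξI)).trans (by gcongr; exact hWle ξ hξI)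
  have e3 : stencilError ε b u s x t =
      -(ε * (deriv (deriv u) ξ - deriv (deriv u) x) * ((t - x) / 2)
      + ε * (deriv (deriv u) ζ - deriv (deriv u) x) * ((x - s) / 2))
      - b x * ((t - s) / 2) * (deriv (deriv u) ξ * ((t - x) / 2)) := by
    unfold stencilError
    rw [e1, e2]
    ring
  rw [e3]
  have p1 : 0 < (t - x) / 2 := by linarith
  have p2 : 0 < (x - s) / 2 := by linarith
  have p3 : 0 < (t - s) / 2 := by linarith
  calc _ ≤ |ε * (deriv (deriv u) ξ - deriv (deriv u) x)| * ((t - x) / 2)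
      + |ε * (deriv (deriv u) ζ - deriv (deriv u) x)| * ((x - s) / 2)
      + |b x| * ((t - s) / 2) * (|deriv (deriv u) ξ| * ((t - x) / 2)) := by
        refine (abs_sub _ _).trans ?_
        rw [abs_neg]
        refine (add_le_add (abs_add_le _ _) le_rfl).trans (le_of_eq ?_)
        simp only [abs_mul _ ((t - x) / 2), abs_mul _ ((x - s) / 2), abs_mul (b x * _),
          abs_mul (b x), abs_of_pos p1, abs_of_pos p2, abs_of_pos p3]
    _ ≤ C * W * (t - s) * ((t - x) / 2) + C * W * (t - s) * ((x - s) / 2)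
      + M * ((t - s) / 2) * (C * W * (t - s)) := by
        gcongr
        linarith
    _ = _ := by ring

/-- `F` is compared with `Φ = A y - (Q / γ) E`, whose derivative is exactly the bound: integrating
`ε⁻¹ E` removes the factor `ε⁻¹`. -/
lemma abs_sub_le_of_layer_deriv {A Q γ ε p r : ℝ} {F F' : ℝ → ℝ} (hγ : 0 < γ) (hε : 0 < ε)
    (hpr : p ≤ r) (hF : ContinuousOn F (Icc p r)) (hQ : 0 ≤ Q)
    (hF' : ∀ y ∈ Ioo p r, HasDerivAt F (F' y) y)
    (hb : ∀ y ∈ Ioo p r, |F' y| ≤ A + Q * (ε⁻¹ * layer γ ε y)) :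
    |F r - F p| ≤ A * (r - p) + Q / γ * layer γ ε p := by
  set Φ : ℝ → ℝ := fun y => A * y - Q / γ * layer γ ε y with hΦ
  have hΦ' : ∀ y, HasDerivAt Φ (A + Q * (ε⁻¹ * layer γ ε y)) y := fun y => by
    refine (((hasDerivAt_id y).const_mul A).sub
      ((hasDerivAt_layer γ ε y).const_mul (Q / γ))).congr_deriv ?_
    field_simp
    ring
  have hΦc : ContinuousOn Φ (Icc p r) := fun y _ => (hΦ' y).continuousAt.continuousWithinAt
  have m1 : MonotoneOn (fun y => Φ y - F y) (Icc p r) := by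
    apply monotoneOn_of_hasDerivWithinAt_nonneg (convex_Icc p r) (hΦc.sub hF)
      (f' := fun y => A + Q * (ε⁻¹ * layer γ ε y) - F' y)
    · intro y hy
      rw [interior_Icc] at hy
      exact ((hΦ' y).sub (hF' y hy)).hasDerivWithinAt
    · intro y hy
      rw [interior_Icc] at hy
      linarith [(abs_le.1 (hb y hy)).2]
  have m2 : MonotoneOn (fun y => Φ y + F y) (Icc p r) := by
    apply monotoneOn_of_hasDerivWithinAt_nonneg (convex_Icc p r) (hΦc.add hF)
      (f' := fun y => A + Q * (ε⁻¹ * layer γ ε y) + F' y)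
    · intro y hy
      rw [interior_Icc] at hy
      exact ((hΦ' y).add (hF' y hy)).hasDerivWithinAt
    · intro y hy
      rw [interior_Icc] at hy
      linarith [(abs_le.1 (hb y hy)).1]
  have h1 := m1 (left_mem_Icc.2 hpr) (right_mem_Icc.2 hpr) hpr
  have h2 := m2 (left_mem_Icc.2 hpr) (right_mem_Icc.2 hpr) hpr
  simp only [hΦ] at h1 h2
  have h3 : 0 ≤ Q / γ * layer γ ε r := mul_nonneg (by positivity) (layer_pos _ _ _).le
  rw [abs_le]
  constructor <;> linarith

/-- This is `z exp (-z) ≤ 1` with `z = γ h / (2 ε)`: moving half a step to the right pays for one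
factor `h / ε`. -/
lemma mul_layer_add_le {γ ε x h : ℝ} (hγ : 0 < γ) (hε : 0 < ε) :
    h * (ε⁻¹ * layer γ ε (x + h / 2)) ≤ 2 / γ * layer γ ε x := by
  have e1 : layer γ ε (x + h / 2) = layer γ ε x * Real.exp (-(γ * h / (2 * ε))) := by
    unfold layer
    rw [← Real.exp_add]
    congr 1
    field_simp
    ring
  have h1 : γ * h / (2 * ε) * Real.exp (-(γ * h / (2 * ε))) ≤ 1 := by
    rw [Real.exp_neg, ← div_eq_mul_inv, div_le_one (Real.exp_pos _)]
    linarith [Real.add_one_le_exp (γ * h / (2 * ε))]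
  calc h * (ε⁻¹ * layer γ ε (x + h / 2))
      = 2 / γ * layer γ ε x * (γ * h / (2 * ε) * Real.exp (-(γ * h / (2 * ε)))) := by
        rw [e1]; field_simp
    _ ≤ 2 / γ * layer γ ε x * 1 := by
        have := layer_pos γ ε x
        gcongr
    _ = _ := mul_one _

/-- Truncation error bound on stencils that see the layer only through an exponentially small
term. -/
lemma HasLayerBounds.abs_stencilError_le' {C γ ε M s x t : ℝ} {b g u : ℝ → ℝ}
    (hu : HasLayerBounds C γ ε b g u) (hC : 0 < C) (hγ : 0 < γ) (hε : 0 < ε) (hM : 0 ≤ M)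
    (hs : 0 ≤ s) (hsx : s < x) (hxt : x < t) (ht : t ≤ 1) (hst : x - s ≤ t - x)
    (hb : ∀ y ∈ Ioo (0 : ℝ) 1, |b y| ≤ M)
    (hb' : ∀ y ∈ Ioo (0 : ℝ) 1, DifferentiableAt ℝ b y ∧ |deriv b y| ≤ M) :
    |stencilError ε b u s x t| ≤
      C * (5 + 3 / γ + M * (2 + 2 / γ + 3 / γ ^ 2)) * (ε + (t - x) ^ 2 + layer γ ε s) := by
  set h := t - x with hh
  -- The differential equation is used at the midpoint, where `h ε⁻¹ E(m)` is bounded by a multiple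
  -- of `E(x)`; at `x` itself this fails.
  set m := x + h / 2 with hm
  set E := layer γ ε s with hEdef
  have hE0 : 0 < E := layer_pos γ ε s
  have hEle : ∀ y, s ≤ y → layer γ ε y ≤ E := fun y hy => layer_le_layer hγ.le hε hy
  have h0 : 0 < h := sub_pos.2 hxt
  have hh1 : h ≤ 1 := by linarith
  have hxm : x < m := by linarith
  have hmt : m < t := by linarith
  have hη0 : 0 < ε⁻¹ := inv_pos.2 hε
  have hεη : ε * ε⁻¹ = 1 := mul_inv_cancel₀ hε.ne'
  have hI : ∀ y ∈ Ioo s t, y ∈ Ioo (0 : ℝ) 1 := fun y hy => ⟨hs.trans_lt hy.1, hy.2.trans_le ht⟩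
  have hxI : x ∈ Ioo (0 : ℝ) 1 := hI x ⟨hsx, hxt⟩
  have hmI : m ∈ Ioo (0 : ℝ) 1 := hI m ⟨hsx.trans hxm, hmt⟩
  have hEm : h * (ε⁻¹ * layer γ ε m) ≤ 2 / γ * E := (mul_layer_add_le hγ hε).trans
    (by have := hEle x hsx.le; gcongr)
  have hEm0 : 0 < layer γ ε m := layer_pos γ ε m
  -- the second order part
  obtain ⟨ξ, hξ, e1⟩ := exists_hasDerivAt_eq_slope u (deriv u) hxt
    (hu.continuousOn.mono (Icc_subset_Icc hxI.1.le ht))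
    (fun y hy => hu.hasDerivAt y (hI y ⟨hsx.trans hy.1, hy.2⟩))
  obtain ⟨ζ, hζ, e2⟩ := exists_hasDerivAt_eq_slope u (deriv u) hsx
    (hu.continuousOn.mono (Icc_subset_Icc hs hxI.2.le))
    (fun y hy => hu.hasDerivAt y (hI y ⟨hy.1, hy.2.trans hxt⟩))
  have hεd : ∀ y ∈ Ioo s t, |ε * deriv u y| ≤ C * (ε + E) := fun y hy => by
    have h1 := hu.abs_deriv_le y (hI y hy)
    have h2 := hEle y hy.1.le
    rw [abs_mul, abs_of_pos hε]
    calc ε * |deriv u y| ≤ ε * (C * (1 + ε⁻¹ * E)) := by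
          gcongr; exact h1.trans (by gcongr)
      _ = C * (ε + (ε * ε⁻¹) * E) := by ring
      _ = _ := by rw [hεη, one_mul]
  have b1 : |ε * ((u t - u x) / (t - x) - (u x - u s) / (x - s))| ≤ 2 * C * (ε + E) := by
    rw [← e1, ← e2, mul_sub]
    have h1 := hεd ξ ⟨hsx.trans hξ.1, hξ.2⟩
    have h2 := hεd ζ ⟨hζ.1, hζ.2.trans hxt⟩
    exact (abs_sub _ _).trans (by linarith)
  -- the first order part
  have b2 : h * |g x - g m| ≤ C * h ^ 2 + C / γ * E := by
    have h1 := abs_sub_le_of_layer_deriv (A := C) (Q := C) (F := g) (F' := deriv g) hγ hε hxm.le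
      (fun y hy => (hu.differentiableAt_rhs y (hI y ⟨hsx.trans_le hy.1,
        hy.2.trans_lt hmt⟩)).continuousAt.continuousWithinAt) hC.le
      (fun y hy => (hu.differentiableAt_rhs y (hI y ⟨hsx.trans hy.1,
        hy.2.trans hmt⟩)).hasDerivAt)
      (fun y hy => (hu.abs_deriv_rhs_le y (hI y ⟨hsx.trans hy.1, hy.2.trans hmt⟩)).trans
        (le_of_eq (by ring)))
    rw [abs_sub_comm] at h1
    have h2 : C / γ * layer γ ε x ≤ C / γ * E := by
      have := hEle x hsx.le
      gcongr
    have h3 : C * (m - x) ≤ C * h := by gcongr; linarith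
    calc h * |g x - g m| ≤ h * (C * h + C / γ * E) := by gcongr; linarith
      _ = C * h ^ 2 + h * (C / γ * E) := by ring
      _ ≤ _ := by
        have : 0 ≤ C / γ * E := by positivity
        linarith [mul_le_of_le_one_left this hh1]
  have b3 : h * |ε * deriv (deriv u) m| ≤ C * ε + C * (2 / γ * E) := by
    have h1 := hu.abs_deriv2_le m hmI
    rw [abs_mul, abs_of_pos hε]
    calc h * (ε * |deriv (deriv u) m|)
        ≤ h * (ε * (C * (1 + ε⁻¹ ^ 2 * layer γ ε m))) := by gcongr
      _ = C * (h * ε) + C * ((ε * ε⁻¹) * (h * (ε⁻¹ * layer γ ε m))) := by ring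
      _ ≤ _ := by
        rw [hεη, one_mul]
        gcongr
        exact mul_le_of_le_one_left hε.le hh1
  have b4 : h * |(b m - b x) * deriv u m| ≤ M * C * h ^ 2 + M * C * (2 / γ * E) := by
    have h1 := (convex_Ioo (0 : ℝ) 1).norm_image_sub_le_of_norm_hasDerivWithin_le
      (f := b) (C := M) (fun z hz => (hb' z hz).1.hasDerivAt.hasDerivWithinAt)
      (fun z hz => (hb' z hz).2) hxI hmI
    rw [Real.norm_eq_abs, Real.norm_eq_abs, abs_of_pos (sub_pos.2 hxm)] at h1
    have h2 := hu.abs_deriv_le m hmI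
    have h3 : |b m - b x| ≤ M * h := h1.trans (by gcongr; linarith)
    rw [abs_mul]
    calc h * (|b m - b x| * |deriv u m|)
        ≤ h * (M * h * (C * (1 + ε⁻¹ * layer γ ε m))) := by gcongr
      _ = M * C * h ^ 2 + M * C * h * (h * (ε⁻¹ * layer γ ε m)) := by ring
      _ ≤ M * C * h ^ 2 + M * C * 1 * (2 / γ * E) := by gcongr
      _ = _ := by ring
  -- The layer term sits at the smaller of `y` and `m`; keeping both terms covers either order.
  have hdu : ∀ y ∈ Ioo x t, |deriv u y - deriv u m| ≤
      (C * h + C / γ * (ε⁻¹ * layer γ ε m)) + C / γ * (ε⁻¹ * layer γ ε y) := fun y hy => by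
    have key : ∀ p r, p ∈ Ioo x t → r ∈ Ioo x t → p ≤ r →
        |deriv u r - deriv u p| ≤ C * h + C / γ * (ε⁻¹ * layer γ ε p) := fun p r hp hr hpr => by
      have h1 := abs_sub_le_of_layer_deriv (A := C) (Q := C * ε⁻¹) (F := deriv u)
        (F' := deriv (deriv u)) hγ hε hpr
        (fun y hy => (hu.hasDerivAt_deriv y (hI y ⟨hsx.trans (hp.1.trans_le hy.1),
          hy.2.trans_lt hr.2⟩)).continuousAt.continuousWithinAt) (by positivity)
        (fun y hy => hu.hasDerivAt_deriv y (hI y ⟨hsx.trans (hp.1.trans hy.1), hy.2.trans hr.2⟩))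
        (fun y hy => (hu.abs_deriv2_le y (hI y ⟨hsx.trans (hp.1.trans hy.1),
          hy.2.trans hr.2⟩)).trans (le_of_eq (by ring)))
      refine h1.trans ?_
      have e1 : C * ε⁻¹ / γ * layer γ ε p = C / γ * (ε⁻¹ * layer γ ε p) := by ring
      rw [e1]
      gcongr
      linarith [hp.1, hr.2]
    have hy0 := layer_pos γ ε y
    rcases le_total y m with hym | hym
    · have h1 := key y m hy ⟨hxm, hmt⟩ hym
      rw [abs_sub_comm] at h1
      have : 0 ≤ C / γ * (ε⁻¹ * layer γ ε m) := by positivity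
      linarith
    · have h1 := key m y ⟨hxm, hmt⟩ hy hym
      have : 0 ≤ C / γ * (ε⁻¹ * layer γ ε y) := by positivity
      linarith
  have b5 : |h * deriv u m - (u t - u x)| ≤ C * h ^ 2 + 3 * C / γ ^ 2 * E := by
    have h1 := abs_sub_le_of_layer_deriv (A := C * h + C / γ * (ε⁻¹ * layer γ ε m)) (Q := C / γ)
      (F := fun y => u y - deriv u m * y) (F' := fun y => deriv u y - deriv u m * 1) hγ hε hxt.le
      ((hu.continuousOn.mono (Icc_subset_Icc hxI.1.le ht)).sub (by fun_prop)) (by positivity)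
      (fun y hy => (hu.hasDerivAt y (hI y ⟨hsx.trans hy.1, hy.2⟩)).sub
        ((hasDerivAt_id y).const_mul (deriv u m)))
      (fun y hy => by rw [mul_one]; exact hdu y hy)
    have e3 : |h * deriv u m - (u t - u x)|
        = |u t - deriv u m * t - (u x - deriv u m * x)| := by
      rw [← abs_neg]; congr 1; rw [hh]; ring
    rw [e3]
    refine h1.trans ?_
    have h2 := hEle x hsx.le
    calc (C * h + C / γ * (ε⁻¹ * layer γ ε m)) * (t - x) + C / γ / γ * layer γ ε x
        = C * h ^ 2 + C / γ * (h * (ε⁻¹ * layer γ ε m)) + C / γ / γ * layer γ ε x := by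
          rw [← hh]; ring
      _ ≤ C * h ^ 2 + C / γ * (2 / γ * E) + C / γ / γ * E := by gcongr
      _ = _ := by field_simp; ring
  have b6 : |(t - s) / 2 * (g x - b x * ((u t - u x) / (t - x)))| ≤
      (C * h ^ 2 + C / γ * E) + (C * ε + C * (2 / γ * E))
      + (M * C * h ^ 2 + M * C * (2 / γ * E)) + M * (C * h ^ 2 + 3 * C / γ ^ 2 * E) := by
    -- `g(m) = ε u''(m) + b(m) u'(m)` is inserted, which leaves the four terms bounded above.
    have e4 : h * (g x - b x * ((u t - u x) / (t - x))) = h * (g x - g m)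
        + h * (ε * deriv (deriv u) m) + h * ((b m - b x) * deriv u m)
        + b x * (h * deriv u m - (u t - u x)) := by
      rw [← hu.eq m hmI, ← hh]
      field_simp
      ring
    have h1 : |h * (g x - b x * ((u t - u x) / (t - x)))| ≤ h * |g x - g m|
        + h * |ε * deriv (deriv u) m| + h * |(b m - b x) * deriv u m|
        + |b x| * |h * deriv u m - (u t - u x)| := by
      rw [e4]
      refine (abs_add_le _ _).trans (add_le_add ((abs_add_le _ _).trans
        (add_le_add ((abs_add_le _ _).trans (le_of_eq ?_)) (le_of_eq ?_))) (le_of_eq ?_))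
      · rw [abs_mul h, abs_mul h, abs_of_pos h0]
      · rw [abs_mul h, abs_of_pos h0]
      · rw [abs_mul]
    have h2 : |b x| * |h * deriv u m - (u t - u x)| ≤ M * (C * h ^ 2 + 3 * C / γ ^ 2 * E) := by
      have := hb x hxI
      gcongr
    refine le_trans ?_ (h1.trans (by linarith))
    rw [abs_mul, abs_mul, abs_of_pos h0, abs_of_pos (show 0 < (t - s) / 2 by linarith)]
    gcongr
    linarith
  -- `ε u''(x)` and `b u'(x)` merge into `g(x)`, so no derivative at `x` has to be estimated.
  have e5 : stencilError ε b u s x t =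
      -(ε * ((u t - u x) / (t - x) - (u x - u s) / (x - s)))
      + (t - s) / 2 * (g x - b x * ((u t - u x) / (t - x))) := by
    unfold stencilError
    rw [← hu.eq x hxI]
    ring
  rw [e5]
  refine (abs_add_le _ _).trans ?_
  rw [abs_neg]
  refine (add_le_add b1 b6).trans ?_
  have p1 : 0 ≤ C / γ := by positivity
  have e6 : C * (5 + 3 / γ + M * (2 + 2 / γ + 3 / γ ^ 2)) * (ε + h ^ 2 + E)
      - (2 * C * (ε + E) + ((C * h ^ 2 + C / γ * E) + (C * ε + C * (2 / γ * E))
      + (M * C * h ^ 2 + M * C * (2 / γ * E)) + M * (C * h ^ 2 + 3 * C / γ ^ 2 * E)))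
      = C * (2 * ε + 4 * h ^ 2 + 3 * E) + 3 * C / γ * (ε + h ^ 2)
        + M * C * (2 * ε + 2 * E) + M * C * (2 / γ + 3 / γ ^ 2) * (ε + h ^ 2) := by
    field_simp
    ring
  have : 0 ≤ C * (2 * ε + 4 * h ^ 2 + 3 * E) + 3 * C / γ * (ε + h ^ 2)
        + M * C * (2 * ε + 2 * E) + M * C * (2 / γ + 3 / γ ^ 2) * (ε + h ^ 2) := by positivity
  linarith

/-! ## The mesh -/

section Mesh

variable {a q ε : ℝ}

lemma discriminant_nonneg (ha : 0 < a) (hq0 : 0 < q) (hq1 : q < 1) (hε : 0 < ε) :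
    0 ≤ a * ε * q * (1 - q + a * ε) := by
  have : 0 < 1 - q := by linarith
  positivity

lemma sub_alpha_eq (ha : 0 < a) (hε : 0 < ε) :
    (q - alpha a q ε) * (1 + a * ε) = a * ε * q + √(a * ε * q * (1 - q + a * ε)) := by
  have : 1 + a * ε ≠ 0 := by positivity
  unfold alpha
  field_simp
  ring

lemma alpha_lt (ha : 0 < a) (hq0 : 0 < q) (hε : 0 < ε) : alpha a q ε < q := by
  have h := sub_alpha_eq (q := q) ha hε
  have h1 : 0 < (q - alpha a q ε) * (1 + a * ε) := by rw [h]; positivity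
  have := pos_of_mul_pos_left h1 (by positivity)
  linarith

lemma alpha_pos (ha : 0 < a) (hq0 : 0 < q) (hq1 : q < 1) (hε : 0 < ε) (hεq : a * ε < q) :
    0 < alpha a q ε := by
  have he : 0 < a * ε := by positivity
  unfold alpha
  apply div_pos _ (by positivity)
  rw [sub_pos, Real.sqrt_lt' hq0]
  have h1 : a * ε * (1 - q + a * ε) < q := by nlinarith
  nlinarith

/-- The tangency condition, as a quadratic equation for `q - α`. -/
lemma sub_alpha_quadratic (ha : 0 < a) (hq0 : 0 < q) (hq1 : q < 1) (hε : 0 < ε) :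
    (q - alpha a q ε) ^ 2 * (1 + a * ε) =
      2 * (a * ε * q) * (q - alpha a q ε) + a * ε * q * (1 - q) := by
  have h := sub_alpha_eq (q := q) ha hε
  have hs := Real.sq_sqrt (discriminant_nonneg ha hq0 hq1 hε)
  set S := √(a * ε * q * (1 - q + a * ε))
  set p := q - alpha a q ε
  have h1 : 1 + a * ε ≠ 0 := by positivity
  apply mul_right_cancel₀ h1
  have hS : S = p * (1 + a * ε) - a * ε * q := by linarith
  rw [hS] at hs
  linear_combination hs

/-- With `sub_alpha_sq_le`, this makes `(q - α)²` comparable to `ε`, and hence `ψ'(α)` to `1`. -/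
lemma le_sub_alpha_sq (ha : 0 < a) (hq0 : 0 < q) (hq1 : q < 1) (hε : 0 < ε) (hεq : a * ε < q) :
    a * ε * q * (1 - q) ≤ (q - alpha a q ε) ^ 2 * (1 + q) := by
  have h := sub_alpha_quadratic ha hq0 hq1 hε
  have h1 := sub_pos.2 (alpha_lt ha hq0 hε)
  have h2 : 0 ≤ 2 * (a * ε * q) * (q - alpha a q ε) := by positivity
  have h3 : (q - alpha a q ε) ^ 2 * (1 + a * ε) ≤ (q - alpha a q ε) ^ 2 * (1 + q) := by gcongr
  linarith

lemma sub_alpha_sq_le (ha : 0 < a) (hq0 : 0 < q) (hq1 : q < 1) (hε : 0 < ε) (hεq : a * ε < q) :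
    (q - alpha a q ε) ^ 2 ≤ 2 * (a * ε * q) := by
  have h := sub_alpha_quadratic ha hq0 hq1 hε
  have h1 := alpha_pos ha hq0 hq1 hε hεq
  have he : 0 < a * ε * q := by positivity
  have h2 : 0 ≤ (q - alpha a q ε) ^ 2 * (a * ε) := by positivity
  have h3 : a * ε * q * (q - alpha a q ε) ≤ a * ε * q * q := by gcongr; linarith
  nlinarith

lemma psi_sub_psi {s t : ℝ} (hs : s < q) (ht : t < q) :
    psi a q ε t - psi a q ε s = a * ε * q * (t - s) / ((q - t) * (q - s)) := by
  have h1 : q - s ≠ 0 := (sub_pos.2 hs).ne'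
  have h2 : q - t ≠ 0 := (sub_pos.2 ht).ne'
  unfold psi
  field_simp
  ring

lemma psiDeriv_le_psiDeriv {s t : ℝ} (ha : 0 < a) (hq0 : 0 < q) (hε : 0 < ε) (hst : s ≤ t)
    (ht : t < q) : psiDeriv a q ε s ≤ psiDeriv a q ε t := by
  have : 0 < q - t := sub_pos.2 ht
  unfold psiDeriv
  gcongr

lemma psi_sub_psi_le {s t : ℝ} (ha : 0 < a) (hq0 : 0 < q) (hε : 0 < ε) (hst : s ≤ t)
    (ht : t < q) : psi a q ε t - psi a q ε s ≤ psiDeriv a q ε t * (t - s) := by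
  have h1 : 0 < q - t := sub_pos.2 ht
  have h2 : 0 ≤ t - s := sub_nonneg.2 hst
  rw [psi_sub_psi (hst.trans_lt ht) ht]
  calc a * ε * q * (t - s) / ((q - t) * (q - s)) ≤ a * ε * q * (t - s) / ((q - t) * (q - t)) := by
        gcongr
    _ = _ := by unfold psiDeriv; ring

lemma le_psi_sub_psi {s t : ℝ} (ha : 0 < a) (hq0 : 0 < q) (hε : 0 < ε) (hst : s ≤ t)
    (ht : t < q) : psiDeriv a q ε s * (t - s) ≤ psi a q ε t - psi a q ε s := by
  have h1 : 0 < q - t := sub_pos.2 ht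
  have h2 : 0 ≤ t - s := sub_nonneg.2 hst
  have h3 : 0 < q - s := by linarith
  rw [psi_sub_psi (hst.trans_lt ht) ht]
  calc psiDeriv a q ε s * (t - s) = a * ε * q * (t - s) / ((q - s) * (q - s)) := by
        unfold psiDeriv; ring
    _ ≤ _ := by gcongr

lemma meshGen_of_le {t : ℝ} (h : t ≤ alpha a q ε) : meshGen a q ε t = psi a q ε t := if_pos h

lemma meshGen_of_ge {t : ℝ} (h : alpha a q ε ≤ t) : meshGen a q ε t =
    psi a q ε (alpha a q ε) + psiDeriv a q ε (alpha a q ε) * (t - alpha a q ε) := by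
  rcases h.eq_or_lt with rfl | h
  · rw [meshGen_of_le le_rfl]; ring
  · exact if_neg h.not_ge

/-- The derivative `λ'` of the mesh-generating function. -/
def meshSlope (a q ε t : ℝ) : ℝ := psiDeriv a q ε (min t (alpha a q ε))

lemma meshSlope_of_ge {t : ℝ} (h : alpha a q ε ≤ t) :
    meshSlope a q ε t = psiDeriv a q ε (alpha a q ε) := by
  rw [meshSlope, min_eq_right h]

lemma meshSlope_pos {t : ℝ} (ha : 0 < a) (hq0 : 0 < q) (hε : 0 < ε) : 0 < meshSlope a q ε t := by
  have h : 0 < q - min t (alpha a q ε) := by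
    linarith [min_le_right t (alpha a q ε), alpha_lt ha hq0 hε]
  unfold meshSlope psiDeriv
  positivity

lemma meshSlope_le (t : ℝ) (ha : 0 < a) (hq0 : 0 < q) (hε : 0 < ε) :
    meshSlope a q ε t ≤ psiDeriv a q ε (alpha a q ε) :=
  psiDeriv_le_psiDeriv ha hq0 hε (min_le_right _ _) (alpha_lt ha hq0 hε)

lemma meshSlope_le_psiDeriv {t : ℝ} (ha : 0 < a) (hq0 : 0 < q) (hε : 0 < ε) (ht : t < q) :
    meshSlope a q ε t ≤ psiDeriv a q ε t :=
  psiDeriv_le_psiDeriv ha hq0 hε (min_le_left _ _) ht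

/-- Convexity of the mesh-generating function. -/
lemma meshGen_sub_mem {s t : ℝ} (ha : 0 < a) (hq0 : 0 < q) (hε : 0 < ε) (hst : s ≤ t) :
    meshSlope a q ε s * (t - s) ≤ meshGen a q ε t - meshGen a q ε s ∧
      meshGen a q ε t - meshGen a q ε s ≤ meshSlope a q ε t * (t - s) := by
  have hα := alpha_lt ha hq0 hε
  rcases le_total t (alpha a q ε) with ht | ht
  · have hs := hst.trans ht
    rw [meshGen_of_le ht, meshGen_of_le hs, meshSlope, meshSlope, min_eq_left ht, min_eq_left hs]
    exact ⟨le_psi_sub_psi ha hq0 hε hst (ht.trans_lt hα),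
      psi_sub_psi_le ha hq0 hε hst (ht.trans_lt hα)⟩
  · rw [meshGen_of_ge ht, meshSlope_of_ge ht]
    rcases le_total s (alpha a q ε) with hs | hs
    · rw [meshGen_of_le hs, meshSlope, min_eq_left hs]
      have h1 := le_psi_sub_psi ha hq0 hε hs hα
      have h2 := psi_sub_psi_le ha hq0 hε hs hα
      have h3 := mul_le_mul_of_nonneg_right (psiDeriv_le_psiDeriv ha hq0 hε hs hα)
        (sub_nonneg.2 ht)
      constructor <;> linarith
    · rw [meshGen_of_ge hs, meshSlope_of_ge hs]
      constructor <;> linarith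

lemma meshGen_lt_meshGen {s t : ℝ} (ha : 0 < a) (hq0 : 0 < q) (hε : 0 < ε) (hst : s < t) :
    meshGen a q ε s < meshGen a q ε t := by
  have := (meshGen_sub_mem ha hq0 hε hst.le).1
  have := mul_pos (meshSlope_pos (t := s) ha hq0 hε) (sub_pos.2 hst)
  linarith

lemma meshGen_le_meshGen {s t : ℝ} (ha : 0 < a) (hq0 : 0 < q) (hε : 0 < ε) (hst : s ≤ t) :
    meshGen a q ε s ≤ meshGen a q ε t := by
  rcases hst.eq_or_lt with rfl | h
  · exact le_rfl
  · exact (meshGen_lt_meshGen ha hq0 hε h).le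

lemma meshGen_zero (ha : 0 < a) (hq0 : 0 < q) (hq1 : q < 1) (hε : 0 < ε) (hεq : a * ε < q) :
    meshGen a q ε 0 = 0 := by
  rw [meshGen_of_le (alpha_pos ha hq0 hq1 hε hεq).le]
  simp [psi]

/-- The tangent line at `α` passes through `(1, 1)`, which is the quadratic equation for `q - α`. -/
lemma meshGen_one (ha : 0 < a) (hq0 : 0 < q) (hq1 : q < 1) (hε : 0 < ε) :
    meshGen a q ε 1 = 1 := by
  have hα := alpha_lt ha hq0 hε
  rw [meshGen_of_ge (by linarith)]
  have h := sub_alpha_quadratic ha hq0 hq1 hε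
  have hp : q - alpha a q ε ≠ 0 := (sub_pos.2 hα).ne'
  unfold psi psiDeriv
  field_simp
  linear_combination -h

lemma half_le_psiDeriv_alpha (ha : 0 < a) (hq0 : 0 < q) (hq1 : q < 1) (hε : 0 < ε)
    (hεq : a * ε < q) : 1 / 2 ≤ psiDeriv a q ε (alpha a q ε) := by
  have hp := sub_pos.2 (alpha_lt ha hq0 hε)
  have h := sub_alpha_sq_le ha hq0 hq1 hε hεq
  unfold psiDeriv
  rw [← mul_div_assoc, le_div_iff₀ (by positivity)]
  linarith

lemma psiDeriv_alpha_le (ha : 0 < a) (hq0 : 0 < q) (hq1 : q < 1) (hε : 0 < ε)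
    (hεq : a * ε < q) : psiDeriv a q ε (alpha a q ε) ≤ 2 / (1 - q) := by
  have hp := sub_pos.2 (alpha_lt ha hq0 hε)
  have h := le_sub_alpha_sq ha hq0 hq1 hε hεq
  have h1 : 0 < 1 - q := by linarith
  unfold psiDeriv
  rw [← mul_div_assoc, div_le_div_iff₀ (by positivity) h1]
  have := mul_le_mul_of_nonneg_left (show 1 + q ≤ 2 by linarith) (sq_nonneg (q - alpha a q ε))
  linarith

/-- The exponent is `γ a - γ a q / (q - t)`, so every power of `q - t` is available. The fourth
cancels the square of `ψ' / ε = a q / (q - t)²`. -/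
lemma layer_psi_le {γ t : ℝ} (ha : 0 < a) (hq0 : 0 < q) (hε : 0 < ε) (hγ : 0 < γ) (ht : t < q) :
    layer γ ε (psi a q ε t) ≤
      Real.exp (γ * a) * (24 / (γ * a * q) ^ 4) * (q - t) ^ 4 := by
  have hr : 0 < q - t := sub_pos.2 ht
  set y := γ * a * q / (q - t) with hy
  have hy0 : 0 < y := by positivity
  have e1 : layer γ ε (psi a q ε t) = Real.exp (γ * a) * (Real.exp y)⁻¹ := by
    unfold layer psi
    rw [← Real.exp_neg, ← Real.exp_add, hy]
    congr 1
    field_simp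
    ring
  have h1 : y ^ 4 / 24 ≤ Real.exp y := by
    have := Real.pow_div_factorial_le_exp y hy0.le 4
    simpa [Nat.factorial] using this
  rw [e1, mul_assoc]
  gcongr
  calc (Real.exp y)⁻¹ ≤ (y ^ 4 / 24)⁻¹ := by gcongr
    _ = _ := by rw [hy]; field_simp

end Mesh

/-! ### Truncation errors on the mesh -/

/-- Uniform bounds for the scaled truncation error on three equidistant parameter values. -/
lemma exists_abs_stencilError_meshGen_le {a q γ C₀ M : ℝ} {b : ℝ → ℝ} (ha : 0 < a) (hq0 : 0 < q)
    (hq1 : q < 1) (hγ : 0 < γ) (hC₀ : 0 < C₀) (hM : 0 < M)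
    (hb : ∀ y ∈ Ioo (0 : ℝ) 1, |b y| ≤ M)
    (hb' : ∀ y ∈ Ioo (0 : ℝ) 1, DifferentiableAt ℝ b y ∧ |deriv b y| ≤ M) :
    ∃ C : ℝ, 0 < C ∧ ∀ (ε : ℝ) (g u : ℝ → ℝ), 0 < ε → a * ε < q →
      HasLayerBounds C₀ γ ε b g u → ∀ s δ : ℝ, 0 ≤ s → 0 < δ → s + 2 * δ ≤ 1 →
      (s < alpha a q ε → |stencilError ε b u (meshGen a q ε s) (meshGen a q ε (s + δ))
        (meshGen a q ε (s + 2 * δ))| ≤ C * δ ^ 2) ∧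
      (alpha a q ε ≤ s → |stencilError ε b u (meshGen a q ε s) (meshGen a q ε (s + δ))
        (meshGen a q ε (s + 2 * δ))| ≤
          C * δ * ((meshGen a q ε (s + 2 * δ) - meshGen a q ε s) / 2)) := by
  have hq : 0 < 1 - q := by linarith
  set K := Real.exp (γ * a) * (24 / (γ * a * q) ^ 4) with hK
  have hK0 : 0 < K := by positivity
  clear_value K
  -- `A₁` serves stencils beyond `α`, `A₂` those with `3 δ ≤ q - s`, and `A₃` the remaining ones.
  set A₁ := C₀ * (1 + M) * (4 / (1 - q) * (1 + 4 * K * (a * q) ^ 2)) with hA₁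
  set A₂ := C₀ * (1 + M) * (8 / (1 - q) ^ 2 + 162 * (a * q) ^ 2 * K) with hA₂
  set A₃ := C₀ * (5 + 3 / γ + M * (2 + 2 / γ + 3 / γ ^ 2)) *
    (9 * (1 + q) / (a * q * (1 - q)) + 4 / (1 - q) ^ 2 + 9 * K) with hA₃
  have hA₁0 : 0 < A₁ := by positivity
  have hA₂0 : 0 < A₂ := by positivity
  have hA₃0 : 0 < A₃ := by positivity
  refine ⟨A₁ + A₂ + A₃, by positivity, fun ε g u hε hεq hu s δ hs hδ hsδ => ?_⟩
  set X := meshGen a q ε s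
  set Y := meshGen a q ε (s + δ)
  set Z := meshGen a q ε (s + 2 * δ)
  have hαq := alpha_lt ha hq0 hε
  have hXY : X < Y := meshGen_lt_meshGen ha hq0 hε (by linarith)
  have hYZ : Y < Z := meshGen_lt_meshGen ha hq0 hε (by linarith)
  have hX0 : 0 ≤ X := by
    rw [← meshGen_zero ha hq0 hq1 hε hεq]; exact meshGen_le_meshGen ha hq0 hε hs
  have hZ1 : Z ≤ 1 := by
    rw [← meshGen_one ha hq0 hq1 hε]; exact meshGen_le_meshGen ha hq0 hε hsδ
  have hYI : Y ∈ Ioo (0 : ℝ) 1 := ⟨hX0.trans_lt hXY, hYZ.trans_le hZ1⟩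
  have hXZ := (meshGen_sub_mem ha hq0 hε (show s ≤ s + 2 * δ by linarith)).2
  rw [show s + 2 * δ - s = 2 * δ by ring] at hXZ
  have hXY' := (meshGen_sub_mem ha hq0 hε (show s ≤ s + δ by linarith)).2
  have hYZ' := meshGen_sub_mem ha hq0 hε (show s + δ ≤ s + 2 * δ by linarith)
  rw [show s + δ - s = δ by ring] at hXY'
  rw [show s + 2 * δ - (s + δ) = δ by ring] at hYZ'
  have hslope := (meshSlope_le (s + 2 * δ) ha hq0 hε).trans (psiDeriv_alpha_le ha hq0 hq1 hε hεq)
  have hd : Z - X ≤ 4 / (1 - q) * δ := by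
    calc Z - X ≤ meshSlope a q ε (s + 2 * δ) * (2 * δ) := hXZ
      _ ≤ 2 / (1 - q) * (2 * δ) := by gcongr
      _ = _ := by ring
  have hd0 : 0 < Z - X := by linarith
  have hE := layer_pos γ ε X
  have hmodeA := hu.abs_stencilError_le hC₀ hγ hε hM.le hX0 hXY hYZ hZ1 (hb Y hYI)
  refine ⟨fun hsα => ?_, fun hsα => ?_⟩
  · have hX : X = psi a q ε s := meshGen_of_le hsα.le
    set r := q - s with hr
    have hr0 : 0 < r := by linarith
    have hEr : layer γ ε X ≤ K * r ^ 4 := by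
      rw [hX, hK]; exact layer_psi_le ha hq0 hε hγ (by linarith)
    -- If `3 δ ≤ r`, then `q - t ≥ r / 3` on the whole stencil, so `λ'` there is at most nine times
    -- `ψ'(s)`.
    rcases le_or_gt (3 * δ) r with hrδ | hrδ
    · have ht : s + 2 * δ < q := by linarith
      have hslope' : meshSlope a q ε (s + 2 * δ) ≤ 9 * (a * ε * q) / r ^ 2 := by
        refine (meshSlope_le_psiDeriv ha hq0 hε ht).trans ?_
        unfold psiDeriv
        have h1 : r / 3 ≤ q - (s + 2 * δ) := by linarith
        calc a * ε * (q / (q - (s + 2 * δ)) ^ 2) ≤ a * ε * (q / (r / 3) ^ 2) := by gcongr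
          _ = _ := by field_simp; norm_num
      have hd' : ε⁻¹ * (Z - X) ≤ 18 * (a * q) / r ^ 2 * δ := by
        calc ε⁻¹ * (Z - X) ≤ ε⁻¹ * (9 * (a * ε * q) / r ^ 2 * (2 * δ)) := by
              have := hXZ.trans (mul_le_mul_of_nonneg_right hslope' (by positivity : 0 ≤ 2 * δ))
              gcongr
          _ = _ := by field_simp; ring
      have h1 : (Z - X) ^ 2 ≤ (4 / (1 - q) * δ) ^ 2 := by gcongr
      have h2 : (ε⁻¹ * (Z - X)) ^ 2 * layer γ ε X ≤
          (18 * (a * q) / r ^ 2 * δ) ^ 2 * (K * r ^ 4) := by gcongr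
      have h3 : (18 * (a * q) / r ^ 2 * δ) ^ 2 * (K * r ^ 4) = 324 * (a * q) ^ 2 * K * δ ^ 2 := by
        field_simp; norm_num
      rw [h3] at h2
      calc _ ≤ C₀ * (1 + M) * ((Z - X) / 2) * ((Z - X) * (1 + ε⁻¹ ^ 2 * layer γ ε X)) := hmodeA
        _ = C₀ * (1 + M) * (((Z - X) ^ 2 + (ε⁻¹ * (Z - X)) ^ 2 * layer γ ε X) / 2) := by ring
        _ ≤ C₀ * (1 + M) * (((4 / (1 - q) * δ) ^ 2 + 324 * (a * q) ^ 2 * K * δ ^ 2) / 2) := by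
          gcongr
        _ = A₂ * δ ^ 2 := by rw [hA₂]; field_simp; ring
        _ ≤ _ := by gcongr; linarith
    · have hmodeB := hu.abs_stencilError_le' hC₀ hγ hε hM.le hX0 hXY hYZ hZ1
        -- Convexity of `λ` gives the required ordering of the two steps.
        (hXY'.trans hYZ'.1) hb hb'
      have h1 : ε ≤ 9 * (1 + q) / (a * q * (1 - q)) * δ ^ 2 := by
        have h := le_sub_alpha_sq ha hq0 hq1 hε hεq
        have hp : (q - alpha a q ε) ^ 2 ≤ (3 * δ) ^ 2 := by
          have : 0 < q - alpha a q ε := by linarith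
          gcongr
          linarith
        rw [div_mul_eq_mul_div, le_div_iff₀ (by positivity)]
        have := mul_le_mul_of_nonneg_right hp (show 0 ≤ 1 + q by linarith)
        linarith
      have h2 : (Z - Y) ^ 2 ≤ 4 / (1 - q) ^ 2 * δ ^ 2 := by
        have h : Z - Y ≤ 2 / (1 - q) * δ := hYZ'.2.trans (by gcongr)
        calc (Z - Y) ^ 2 ≤ (2 / (1 - q) * δ) ^ 2 := by
              have : 0 ≤ Z - Y := by linarith
              gcongr
          _ = _ := by rw [mul_pow, div_pow]; norm_num
      have h3 : layer γ ε X ≤ 9 * K * δ ^ 2 := by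
        have hr1 : r ^ 2 ≤ 1 := by
          have : r ≤ 1 := by linarith
          exact pow_le_one₀ hr0.le this
        calc layer γ ε X ≤ K * r ^ 4 := hEr
          _ = K * (r ^ 2 * r ^ 2) := by ring
          _ ≤ K * (1 * (3 * δ) ^ 2) := by gcongr
          _ = _ := by ring
      calc _ ≤ _ := hmodeB
        _ ≤ C₀ * (5 + 3 / γ + M * (2 + 2 / γ + 3 / γ ^ 2)) *
            (9 * (1 + q) / (a * q * (1 - q)) * δ ^ 2 + 4 / (1 - q) ^ 2 * δ ^ 2
              + 9 * K * δ ^ 2) := by gcongr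
        _ = A₃ * δ ^ 2 := by rw [hA₃]; ring
        _ ≤ _ := by gcongr; linarith
  · have hEα : ε⁻¹ ^ 2 * layer γ ε X ≤ 4 * K * (a * q) ^ 2 := by
      have h1 : layer γ ε X ≤ K * (q - alpha a q ε) ^ 4 := by
        refine (layer_le_layer hγ.le hε (meshGen_le_meshGen ha hq0 hε hsα)).trans ?_
        rw [meshGen_of_le le_rfl, hK]
        exact layer_psi_le ha hq0 hε hγ hαq
      have h2 := sub_alpha_sq_le ha hq0 hq1 hε hεq
      calc ε⁻¹ ^ 2 * layer γ ε X ≤ ε⁻¹ ^ 2 * (K * ((q - alpha a q ε) ^ 2) ^ 2) := by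
            gcongr; exact h1.trans (le_of_eq (by ring))
        _ ≤ ε⁻¹ ^ 2 * (K * (2 * (a * ε * q)) ^ 2) := by gcongr
        _ = _ := by field_simp; ring
    calc _ ≤ C₀ * (1 + M) * ((Z - X) / 2) * ((Z - X) * (1 + ε⁻¹ ^ 2 * layer γ ε X)) := hmodeA
      _ ≤ C₀ * (1 + M) * ((Z - X) / 2) * (4 / (1 - q) * δ * (1 + 4 * K * (a * q) ^ 2)) := by
        gcongr
      _ = A₁ * δ * ((Z - X) / 2) := by rw [hA₁]; ring
      _ ≤ _ := by gcongr; linarith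

lemma avgStep_mul_consistencyError {ε : ℝ} {b c u : ℝ → ℝ} {x : ℕ → ℝ} {i : ℕ}
    (h : avgStep x i ≠ 0) : avgStep x i * consistencyError ε b c x u i =
      stencilError ε b u (x (i - 1)) (x i) (x (i + 1)) := by
  have e : (x (i + 1) - x (i - 1)) / 2 = avgStep x i := by
    simp only [avgStep, step, Nat.add_sub_cancel]; ring
  unfold stencilError
  rw [e]
  simp only [consistencyError, discOp, contOp, diff2, diff1]
  simp only [step, Nat.add_sub_cancel]
  field_simp
  ring

lemma coarseStep_eq {a q ε : ℝ} {N : ℕ} (hN : 0 < N) :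
    coarseStep a q ε N = psiDeriv a q ε (alpha a q ε) * (N : ℝ)⁻¹ := by
  have hN' : (0 : ℝ) < N := by exact_mod_cast hN
  have h1 : alpha a q ε ≤ (transIdx a q ε N : ℝ) / N := by
    rw [le_div_iff₀ hN']; exact Nat.le_ceil _
  have h2 : (transIdx a q ε N : ℝ) / N ≤ ((transIdx a q ε N + 1 : ℕ) : ℝ) / N := by
    gcongr; simp
  rw [coarseStep, meshPt, meshPt, meshGen_of_ge h1, meshGen_of_ge (h1.trans h2)]
  push_cast
  field_simp
  ring

end VBMesh

end

theorem lemma3 (b c f : ℝ → ℝ) (β a q : ℝ)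
    (hb : ContDiffOn ℝ 1 b (Set.Icc 0 1))
    (hc : ContDiffOn ℝ 1 c (Set.Icc 0 1))
    (hf : ContDiffOn ℝ 1 f (Set.Icc 0 1))
    (hβ : 0 < β) (hbβ : ∀ x ∈ Set.Icc (0 : ℝ) 1, β ≤ b x)
    (hc0 : ∀ x ∈ Set.Icc (0 : ℝ) 1, 0 ≤ c x)
    (ha : 0 < a) (hq0 : 0 < q) (hq1 : q < 1) :
    ∃ C : ℝ, 0 < C ∧ ∀ ε : ℝ, 0 < ε → a * ε < q →
      ∀ u : ℝ → ℝ, VBMesh.IsSolution ε b c f u →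
        ∀ N i : ℕ, 1 ≤ i → i < N →
          |VBMesh.scaledError a q ε b c N u i| ≤ C * (N : ℝ)⁻¹ := by
  open VBMesh in
  obtain ⟨M, hM, hb0, hb1⟩ := exists_bound_of_contDiffOn hb
  -- The hypothesis `a ε < q` bounds `ε` by `q / a`; adding `1` ensures `1 ≤ ε₁`.
  obtain ⟨C₀, hC₀, hlayer⟩ := exists_hasLayerBounds (γ := β / 2) (ε₁ := q / a + 1) hb hc hf
    (by positivity) (fun x hx => by linarith [hbβ x hx]) hc0
    (by have : 0 < q / a := by positivity
        linarith)
  obtain ⟨C, hC, hmesh⟩ := exists_abs_stencilError_meshGen_le ha hq0 hq1 (half_pos hβ) hC₀ hM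
    (fun y hy => hb0 y (Set.Ioo_subset_Icc_self hy)) hb1
  refine ⟨2 * C, by positivity, fun ε hε hεq u hu N i hi hiN => ?_⟩
  have hN : 0 < N := by omega
  have hN' : (0 : ℝ) < N := by exact_mod_cast hN
  set δ := (N : ℝ)⁻¹ with hδ
  have hδ0 : 0 < δ := by positivity
  have hu' := hlayer ε hε (by
    have : ε ≤ q / a := by rw [le_div_iff₀ ha]; linarith
    linarith) u hu
  obtain ⟨k, rfl⟩ : ∃ k, i = k + 1 := ⟨i - 1, by omega⟩
  set s : ℝ := (k : ℝ) / N with hs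
  have hkN : (k : ℝ) + 2 ≤ N := by exact_mod_cast hiN
  have e0 : meshPt a q ε N k = meshGen a q ε s := rfl
  have e1 : meshPt a q ε N (k + 1) = meshGen a q ε (s + δ) := by
    rw [meshPt]; congr 1; push_cast; rw [hs, hδ]; ring
  have e2 : meshPt a q ε N (k + 1 + 1) = meshGen a q ε (s + 2 * δ) := by
    rw [meshPt]; congr 1; push_cast; rw [hs, hδ]; ring
  have hs1 : s + 2 * δ ≤ 1 := by
    rw [hs, hδ, ← div_eq_mul_inv, ← add_div, div_le_one hN']; exact hkN
  obtain ⟨hfine, hcoarse⟩ := hmesh ε _ u hε hεq hu' s δ (by positivity) hδ0 hs1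
  have havg : avgStep (meshPt a q ε N) (k + 1)
      = (meshGen a q ε (s + 2 * δ) - meshGen a q ε s) / 2 := by
    simp only [avgStep, step, Nat.add_sub_cancel, e0, e1, e2]; ring
  have havg0 : 0 < avgStep (meshPt a q ε N) (k + 1) := by
    have := meshGen_lt_meshGen ha hq0 hε (show s < s + 2 * δ by linarith)
    rw [havg]; linarith
  have hst := avgStep_mul_consistencyError (ε := ε) (b := b) (c := c) (u := u) havg0.ne'
  rw [Nat.add_sub_cancel, e0, e1, e2] at hst
  unfold scaledError
  -- Since `J = ⌈α N⌉`, `i ≤ J` holds exactly when the left stencil parameter `s = (i - 1) / N` is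
  -- below `α`.
  split_ifs with hJ
  · have hsα : s < alpha a q ε := by
      rw [hs, div_lt_iff₀ hN']
      exact Nat.lt_ceil.1 (Nat.lt_of_succ_le hJ)
    have hH := coarseStep_eq (a := a) (q := q) (ε := ε) hN
    have hH' : δ / 2 ≤ coarseStep a q ε N := by
      rw [hH]
      have := mul_le_mul_of_nonneg_right (half_le_psiDeriv_alpha ha hq0 hq1 hε hεq) hδ0.le
      linarith
    have hH0 : 0 < coarseStep a q ε N := by linarith
    rw [div_mul_eq_mul_div, hst, abs_div, abs_of_pos hH0, div_le_iff₀ hH0]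
    calc _ ≤ C * δ ^ 2 := hfine hsα
      _ = 2 * C * δ * (δ / 2) := by ring
      _ ≤ _ := by gcongr
  · have hsα : alpha a q ε ≤ s := by
      rw [hs, le_div_iff₀ hN']
      exact Nat.ceil_le.1 (Nat.lt_succ_iff.1 (not_le.1 hJ))
    have h := hcoarse hsα
    rw [← hst, ← havg, abs_mul, abs_of_pos havg0, mul_comm] at h
    have h2 := le_of_mul_le_mul_right h havg0
    have : 0 < C * δ := by positivity
    linarith
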